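/- Let $z_0\in\mathbb{C}$. For a function $f$ meromorphic in $\overline{\mathbb{C}}\setminus\{z_0\}$ let $n(t,f)$ be the number of poles of $f$ in $\{z\in\mathbb{C}: t\le |z-z_0|\}\cup\{\infty\}$, and $n(\infty,f)$ the multiplicity of $\infty$ as a pole of $f$ (poles are counted with multiplicity), and put, for $r>0$, $$m_{z_0}(r,f)=\frac1{2\pi}\int_0^{2\pi}\log^+|f(z_0-re^{i\varphi})|\,d\varphi,$$ $$N_{z_0}(r,f)=\int_r^\infty\frac{n(t,f)-n(\infty,f)}{t}\,dt-n(\infty,f)\log r,\qquad T_{z_0}(r,f)=m_{z_0}(r,f)+N_{z_0}(r,f).$$ Define the logarithmic order, the logarithmic lower order and the lower $[2,2]$-order of $f$ near $z_0$, with values in $[0,+\infty]$, by $$\sigma_{\log}(f,z_0)=\limsup_{r\to0^+}\frac{\log^+T_{z_0}(r,f)}{\log\log\frac1r},\quad \mu_{\log}(f,z_0)=\liminf_{r\to0^+}\frac{\log^+T_{z_0}(r,f)}{\log\log\frac1r},\quad \mu_{[2,2]}(f,z_0)=\liminf_{r\to0^+}\frac{\log^+\log^+T_{z_0}(r,f)}{\log\log\frac1r}.$$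 Theorem. Let $k\ge1$ and let $A_0,\dots,A_{k-1}$ be meromorphic functions in $\overline{\mathbb{C}}\setminus\{z_0\}$ of finite logarithmic order such that $$\liminf_{r\to0^+}\frac{m_{z_0}(r,A_0)}{T_{z_0}(r,A_0)}=\delta>0\qquad\text{and}\qquad \limsup_{r\to0^+}\frac{\sum_{j=1}^{k-1}m_{z_0}(r,A_j)}{m_{z_0}(r,A_0)}<1.$$ Then every meromorphic solution $f\not\equiv0$ in $\overline{\mathbb{C}}\setminus\{z_0\}$ of $$f^{(k)}+A_{k-1}(z)f^{(k-1)}+\cdots+A_1(z)f'+A_0(z)f=0$$ satisfies $\mu_{\log}(A_0,z_0)-1\le\mu_{[2,2]}(f,z_0)$, and $\mu_{\log}(A_0,z_0)\le\mu_{[2,2]}(f,z_0)$ if $\mu_{\log}(A_0,z_0)>1$. Moreover $0\le\mu_{\log}(A_0,z_0)-1$ if $A_0$ is non-constant. -/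

import Mathlib

open Filter Topology

noncomputable section

namespace PuncturedSphere

/-- `f` is meromorphic in the extended complex plane with the finite point `z₀` removed. The value
of `f` at `z₀` and its values on discrete subsets of the punctured plane are irrelevant. -/
def IsMeromorphic (f : ℂ → ℂ) (z₀ : ℂ) : Prop :=
  MeromorphicOn f {z₀}ᶜ ∧ MeromorphicAt (fun w ↦ f w⁻¹) 0

/-- Two meromorphic functions on the punctured sphere agree, that is, they agree off a closed
discrete subset of the complex plane with `z₀` removed. -/
def SameFun (f g : ℂ → ℂ) (z₀ : ℂ) : Prop :=
  f =ᶠ[codiscreteWithin {z₀}ᶜ] g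

/-- Multiplicity of the point `z` as a pole of `f` (zero if `z` is not a pole). -/
def poleMult (f : ℂ → ℂ) (z : ℂ) : ℕ :=
  (-(meromorphicOrderAt f z).untop₀).toNat

/-- `n(∞, f)`: multiplicity of the point at infinity as a pole of `f`. -/
def poleMultInfty (f : ℂ → ℂ) : ℕ :=
  poleMult (fun w ↦ f w⁻¹) 0

/-- `n(t, f)`: the number of poles of `f` in `{z ∈ ℂ : t ≤ |z - z₀|} ∪ {∞}`, counted with
multiplicity. -/
def poleCount (f : ℂ → ℂ) (z₀ : ℂ) (t : ℝ) : ℕ :=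
  (∑ᶠ z ∈ {z : ℂ | t ≤ ‖z - z₀‖}, poleMult f z) + poleMultInfty f

/-- The counting function
`N(r, f) = -∫_∞^r (n(t, f) - n(∞, f)) / t dt - n(∞, f) log r` near `z₀`. -/
def counting (f : ℂ → ℂ) (z₀ : ℂ) (r : ℝ) : ℝ :=
  (∫ t in Set.Ioi r, ((poleCount f z₀ t : ℝ) - (poleMultInfty f : ℝ)) / t)
    - (poleMultInfty f : ℝ) * Real.log r

/-- The proximity function near `z₀`: the mean of `log⁺ |f|` over the circle `|z - z₀| = r`. -/
def proximity (f : ℂ → ℂ) (z₀ : ℂ) (r : ℝ) : ℝ :=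
  (2 * Real.pi)⁻¹ * ∫ φ in (0 : ℝ)..(2 * Real.pi),
    Real.posLog ‖f (z₀ - (r : ℂ) * Complex.exp (Complex.I * (φ : ℂ)))‖

/-- The characteristic function `T(r, f) = m(r, f) + N(r, f)` near `z₀`. -/
def characteristic (f : ℂ → ℂ) (z₀ : ℂ) (r : ℝ) : ℝ :=
  proximity f z₀ r + counting f z₀ r

/-- The logarithmic order `limsup_{r → 0⁺} log⁺ T(r, f) / log log (1 / r)`. -/
def logOrder (f : ℂ → ℂ) (z₀ : ℂ) : EReal :=
  limsup (fun r : ℝ ↦ ((Real.posLog (characteristic f z₀ r) / Real.log (Real.log (1 / r)) : ℝ)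
    : EReal)) (𝓝[>] 0)

/-- The logarithmic lower order `liminf_{r → 0⁺} log⁺ T(r, f) / log log (1 / r)`. -/
def logLowerOrder (f : ℂ → ℂ) (z₀ : ℂ) : EReal :=
  liminf (fun r : ℝ ↦ ((Real.posLog (characteristic f z₀ r) / Real.log (Real.log (1 / r)) : ℝ)
    : EReal)) (𝓝[>] 0)

/-- The lower `[2,2]`-order `liminf_{r → 0⁺} log⁺ log⁺ T(r, f) / log log (1 / r)`. -/
def lowerOrder22 (f : ℂ → ℂ) (z₀ : ℂ) : EReal :=
  liminf (fun r : ℝ ↦ ((Real.posLog (Real.posLog (characteristic f z₀ r)) /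
    Real.log (Real.log (1 / r)) : ℝ) : EReal)) (𝓝[>] 0)

/-- The meromorphic function `f` solves `f⁽ᵏ⁾ + A_{k-1} f⁽ᵏ⁻¹⁾ + ⋯ + A_1 f' + A_0 f = 0` on the
punctured sphere, as an identity between meromorphic functions. -/
def IsSolution (k : ℕ) (A : ℕ → ℂ → ℂ) (f : ℂ → ℂ) (z₀ : ℂ) : Prop :=
  SameFun (fun z ↦ iteratedDeriv k f z + ∑ j ∈ Finset.range k, A j z * iteratedDeriv j f z)
    (fun _ ↦ 0) z₀

end PuncturedSphere

end

/-! In the coordinate `w = (z₀ - z)⁻¹` the punctured sphere becomes the plane, `z₀` becomes infinity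
and `d/dz` becomes `D = w² d/dw`. The functions `m`, `N`, `T` near `z₀` at `r` become the classical
Nevanlinna functions at `R = 1/r` (`proximity_eq`, `counting_eq`), so the claim concerns a linear
equation in `D` with meromorphic coefficients in the plane.

The analytic core is the lemma on the logarithmic derivative, `exists_proximity_logDeriv_le`. It has
no exceptional set, at the price of evaluating the characteristic at `4R`; a fixed dilation does not
affect logarithmic orders. Iterating it gives `m(R, Dʲg/g) = O(log⁺ T(4ʲR, g) + log R + 1)`.
Dividing the equation by `g` expresses `-A₀` through the `A_j · Dʲg/g` and `Dᵏg/g`. The two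
hypotheses on `A₀` allow the `A_j` to be absorbed and `m` to be replaced by `T`
(`exists_mul_characteristic_le`): `T(r, A₀) ≤ K (log⁺ T(r/4ᵏ, f) + log (1/r) + 1)`.

If the logarithmic lower order `μ` of `A₀` exceeds 1, the left side eventually dominates `(log
1/r)ᵇ` for some `b > 1`. The term `log (1/r)` is then negligible, so `log⁺ T(r, f)` grows at least
like a power of `log (1/r)` with exponent arbitrarily close to `μ`. If `μ ≤ 1`, then `μ - 1 ≤ 0` and
the bound is trivial. Finally, a nonconstant function has `T ≥ log (1/r) - O(1)`, whence `μ ≥ 1`. -/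

open Filter Topology

namespace PuncturedSphere

/-! ### The coordinate change from the punctured sphere to the plane -/

/-- The function `f` near `z₀` in the coordinate `w = (z₀ - z)⁻¹`, in which the punctured sphere
becomes the complex plane. -/
noncomputable def toPlane (f : ℂ → ℂ) (z₀ : ℂ) : ℂ → ℂ := fun w ↦ f (z₀ - w⁻¹)

lemma analyticAt_sub_inv {z₀ w : ℂ} (hw : w ≠ 0) : AnalyticAt ℂ (fun w : ℂ ↦ z₀ - w⁻¹) w :=
  analyticAt_const.sub (analyticAt_id.inv hw)

lemma hasDerivAt_sub_inv {z₀ w : ℂ} (hw : w ≠ 0) :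
    HasDerivAt (fun w : ℂ ↦ z₀ - w⁻¹) ((w ^ 2)⁻¹) w := by
  simpa using (hasDerivAt_inv hw).const_sub z₀

lemma meromorphicOrderAt_toPlane {f : ℂ → ℂ} {z₀ w : ℂ} (hw : w ≠ 0) :
    meromorphicOrderAt (toPlane f z₀) w = meromorphicOrderAt f (z₀ - w⁻¹) := by
  have := meromorphicOrderAt_comp_of_deriv_ne_zero (f := f) (analyticAt_sub_inv (z₀ := z₀) hw)
    (by rw [(hasDerivAt_sub_inv hw).deriv]; positivity)
  exact this

/-- The coordinate change at infinity between `z⁻¹` and `(z₀ - z)⁻¹`. -/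
noncomputable def inftyChart (z₀ : ℂ) : ℂ → ℂ := fun w ↦ w / (z₀ * w - 1)

lemma hasDerivAt_inftyChart (z₀ : ℂ) : HasDerivAt (inftyChart z₀) (-1) 0 := by
  have h := (hasDerivAt_id (0 : ℂ)).div (((hasDerivAt_id (0 : ℂ)).const_mul z₀).sub_const 1)
    (by simp)
  simpa [inftyChart] using! h

lemma analyticAt_inftyChart (z₀ : ℂ) : AnalyticAt ℂ (inftyChart z₀) 0 :=
  analyticAt_id.div ((analyticAt_const.mul analyticAt_id).sub analyticAt_const) (by simp)

lemma toPlane_eventuallyEq_inftyChart (f : ℂ → ℂ) (z₀ : ℂ) :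
    toPlane f z₀ =ᶠ[𝓝[≠] 0] (fun w ↦ f w⁻¹) ∘ inftyChart z₀ := by
  filter_upwards [self_mem_nhdsWithin] with w hw
  have hw : w ≠ 0 := hw
  simp only [toPlane, inftyChart, Function.comp]
  congr 1
  field_simp

lemma meromorphicOrderAt_toPlane_zero (f : ℂ → ℂ) (z₀ : ℂ) :
    meromorphicOrderAt (toPlane f z₀) 0 = meromorphicOrderAt (fun w ↦ f w⁻¹) 0 := by
  rw [meromorphicOrderAt_congr (toPlane_eventuallyEq_inftyChart f z₀),
    meromorphicOrderAt_comp_of_deriv_ne_zero (analyticAt_inftyChart z₀)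
      (by rw [(hasDerivAt_inftyChart z₀).deriv]; norm_num)]
  simp [inftyChart]

lemma IsMeromorphic.toPlane {f : ℂ → ℂ} {z₀ : ℂ} (hf : IsMeromorphic f z₀) :
    Meromorphic (toPlane f z₀) := by
  intro w
  by_cases hw : w = 0
  · subst hw
    refine MeromorphicAt.congr ?_ (toPlane_eventuallyEq_inftyChart f z₀).symm
    refine MeromorphicAt.comp_analyticAt (𝕜 := ℂ) ?_ (analyticAt_inftyChart z₀)
    simpa [inftyChart] using hf.2
  · exact MeromorphicAt.comp_analyticAt (𝕜 := ℂ) (hf.1 (z₀ - w⁻¹) (by simpa using hw))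
      (analyticAt_sub_inv hw)

/-- The derivation `w² d/dw`, which is `d/dz` in the coordinate `w = (z₀ - z)⁻¹`. -/
noncomputable def sqDeriv (g : ℂ → ℂ) : ℂ → ℂ := fun w ↦ w ^ 2 * deriv g w

lemma _root_.Meromorphic.sqDeriv {g : ℂ → ℂ} (hg : Meromorphic g) :
    Meromorphic (sqDeriv g) :=
  fun w ↦ ((MeromorphicAt.id w).pow 2).mul (hg w).deriv

lemma _root_.Meromorphic.sqDeriv_iterate {g : ℂ → ℂ} (hg : Meromorphic g) (j : ℕ) :
    Meromorphic (PuncturedSphere.sqDeriv^[j] g) := by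
  induction j with
  | zero => exact hg
  | succ j ih => rw [Function.iterate_succ_apply']; exact ih.sqDeriv

/-- The chart is locally invertible, so where `f` is not differentiable neither is its transform and
both derivatives take the default value 0. The identity is therefore pointwise, which is what makes
it iterable. -/
lemma toPlane_deriv (f : ℂ → ℂ) (z₀ : ℂ) {w : ℂ} (hw : w ≠ 0) :
    toPlane (deriv f) z₀ w = sqDeriv (toPlane f z₀) w := by
  have hσ := hasDerivAt_sub_inv (z₀ := z₀) hw
  by_cases hf : DifferentiableAt ℂ f (z₀ - w⁻¹)
  · have h : HasDerivAt (toPlane f z₀) (deriv f (z₀ - w⁻¹) * (w ^ 2)⁻¹) w :=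
      hf.hasDerivAt.comp w hσ
    rw [sqDeriv, h.deriv, toPlane]
    field_simp
  · have hg : ¬ DifferentiableAt ℂ (toPlane f z₀) w := by
      intro hg
      apply hf
      have hw' : (z₀ - (z₀ - w⁻¹))⁻¹ = w := by simp
      have hτ : DifferentiableAt ℂ (fun z ↦ (z₀ - z)⁻¹) (z₀ - w⁻¹) :=
        (differentiableAt_id.const_sub z₀).inv (by simpa using hw)
      have hcomp : DifferentiableAt ℂ (toPlane f z₀ ∘ fun z ↦ (z₀ - z)⁻¹) (z₀ - w⁻¹) :=
        DifferentiableAt.comp _ (by rwa [hw']) hτ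
      exact hcomp.congr_of_eventuallyEq (Eventually.of_forall fun z ↦ by simp [toPlane])
    rw [sqDeriv, deriv_zero_of_not_differentiableAt hg, toPlane,
      deriv_zero_of_not_differentiableAt hf, mul_zero]

lemma toPlane_iteratedDeriv (f : ℂ → ℂ) (z₀ : ℂ) (j : ℕ) {w : ℂ} (hw : w ≠ 0) :
    toPlane (iteratedDeriv j f) z₀ w = sqDeriv^[j] (toPlane f z₀) w := by
  induction j generalizing w with
  | zero => simp
  | succ j ih =>
    rw [iteratedDeriv_succ, toPlane_deriv _ _ hw, Function.iterate_succ_apply', sqDeriv, sqDeriv]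
    congr 1
    apply Filter.EventuallyEq.deriv_eq
    filter_upwards [isOpen_ne.mem_nhds hw] with v hv using ih hv

/-- A meromorphic function on the plane that vanishes near one point, up to a punctured
neighbourhood, vanishes on a codiscrete set. -/
lemma _root_.Meromorphic.eventuallyEq_zero_codiscrete {g : ℂ → ℂ} (hg : Meromorphic g) {x : ℂ}
    (hx : meromorphicOrderAt g x = ⊤) : g =ᶠ[codiscrete ℂ] 0 := by
  have h : ∀ u, meromorphicOrderAt g u = ⊤ := by
    by_contra! h
    exact (hg.exists_meromorphicOrderAt_ne_top_iff_forall.1 h) x hx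
  refine mem_codiscrete.2 fun u ↦ ?_
  rw [disjoint_principal_right, compl_compl]
  exact meromorphicOrderAt_eq_top_iff.1 (h u)

/-- The point `w = 0` is excluded because it corresponds to `z = ∞`, where the exceptional set in
`SameFun` may accumulate. -/
lemma toPlane_eventuallyEq_of_sameFun {P Q : ℂ → ℂ} {z₀ : ℂ} (h : SameFun P Q z₀) {w : ℂ}
    (hw : w ≠ 0) : toPlane P z₀ =ᶠ[𝓝[≠] w] toPlane Q z₀ := by
  have h1 := mem_codiscreteWithin.1 h (z₀ - w⁻¹) (by simpa using hw)
  rw [disjoint_principal_right] at h1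
  have hσ : Tendsto (fun w : ℂ ↦ z₀ - w⁻¹) (𝓝[≠] w) (𝓝[≠] (z₀ - w⁻¹)) :=
    (hasDerivAt_sub_inv hw).tendsto_nhdsNE (by positivity)
  filter_upwards [hσ h1, nhdsWithin_le_nhds (isOpen_ne.mem_nhds hw)] with v hv hv0
  by_contra hne
  exact hv ⟨by simpa using hv0, hne⟩

lemma sameFun_of_toPlane_eventuallyEq {P Q : ℂ → ℂ} {z₀ : ℂ}
    (h : toPlane P z₀ =ᶠ[codiscrete ℂ] toPlane Q z₀) : SameFun P Q z₀ := by
  refine mem_codiscreteWithin.2 fun z hz ↦ ?_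
  have hz : z₀ - z ≠ 0 := sub_ne_zero.2 (Ne.symm hz)
  have h1 := mem_codiscrete.1 h (z₀ - z)⁻¹
  rw [disjoint_principal_right, compl_compl] at h1
  have hτ' : HasDerivAt (fun z ↦ (z₀ - z)⁻¹) (((z₀ - z) ^ 2)⁻¹) z := by
    simpa using! ((hasDerivAt_id z).const_sub z₀).inv hz
  rw [disjoint_principal_right]
  filter_upwards [hτ'.tendsto_nhdsNE (by positivity) h1] with v hv
  rintro ⟨-, hne⟩
  exact hne (by simpa [toPlane] using hv)

/-! ### Comparison with the Nevanlinna functions of the plane -/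

lemma proximity_eq (f : ℂ → ℂ) (z₀ : ℂ) (r : ℝ) :
    proximity f z₀ r = ValueDistribution.proximity (toPlane f z₀) ⊤ r⁻¹ := by
  rw [ValueDistribution.proximity_top, Real.circleAverage_def, proximity, smul_eq_mul]
  congr 1
  set G : ℝ → ℝ := fun θ ↦ Real.posLog ‖toPlane f z₀ (circleMap 0 r⁻¹ θ)‖ with hG
  have hper : Function.Periodic G (2 * Real.pi) := fun θ ↦ by
    simp only [hG, periodic_circleMap 0 r⁻¹ θ]
  have h1 : ∀ φ : ℝ, Real.posLog ‖f (z₀ - (r : ℂ) * Complex.exp (Complex.I * (φ : ℂ)))‖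
      = G (-φ) := by
    intro φ
    simp only [hG, toPlane, circleMap_zero, mul_inv, ← Complex.exp_neg]
    congr 4
    push_cast
    rw [inv_inv]
    congr 2
    ring
  simp_rw [h1]
  rw [intervalIntegral.integral_comp_neg, neg_zero]
  have := hper.intervalIntegral_add_eq (-(2 * Real.pi)) 0
  simpa using this

lemma poleMult_eq {f : ℂ → ℂ} {z₀ : ℂ} (hf : IsMeromorphic f z₀) {w : ℂ} (hw : w ≠ 0) :
    ((poleMult f (z₀ - w⁻¹) : ℕ) : ℤ)
      = (MeromorphicOn.divisor (toPlane f z₀) Set.univ)⁻ w := by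
  rw [Function.locallyFinsuppWithin.negPart_apply,
    MeromorphicOn.divisor_apply hf.toPlane.meromorphicOn (Set.mem_univ _),
    meromorphicOrderAt_toPlane hw, poleMult, negPart_def, Int.toNat_eq_max]

lemma poleMultInfty_eq {f : ℂ → ℂ} {z₀ : ℂ} (hf : IsMeromorphic f z₀) :
    ((poleMultInfty f : ℕ) : ℤ)
      = (MeromorphicOn.divisor (toPlane f z₀) Set.univ)⁻ 0 := by
  rw [Function.locallyFinsuppWithin.negPart_apply,
    MeromorphicOn.divisor_apply hf.toPlane.meromorphicOn (Set.mem_univ _),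
    meromorphicOrderAt_toPlane_zero, poleMultInfty, poleMult, negPart_def, Int.toNat_eq_max]

/-- A single pole at distance `ρ` from `z₀` is counted exactly for `t ≤ ρ`; this is its share of the
integral defining `N`. -/
lemma integral_Ioi_indicator_inv {r ρ : ℝ} (hr : 0 < r) (h : r ≤ ρ) :
    MeasureTheory.IntegrableOn (fun t ↦ (if t ≤ ρ then t⁻¹ else 0)) (Set.Ioi r) ∧
    ∫ t in Set.Ioi r, (if t ≤ ρ then t⁻¹ else 0) = Real.log (ρ / r) := by
  have h0 : (0 : ℝ) ∉ Set.uIcc r ρ := by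
    rw [Set.uIcc_of_le h]
    exact fun h ↦ hr.not_ge h.1
  have he : (fun t : ℝ ↦ (if t ≤ ρ then t⁻¹ else 0)) = (Set.Iic ρ).indicator fun t ↦ t⁻¹ := by
    ext t
    simp [Set.indicator]
  have hint : MeasureTheory.IntegrableOn (fun t : ℝ ↦ t⁻¹) (Set.Ioc r ρ) :=
    (intervalIntegrable_iff_integrableOn_Ioc_of_le h).1 (intervalIntegrable_inv_iff.2
      (Or.inr h0))
  constructor
  · rw [he, MeasureTheory.integrableOn_indicator_iff measurableSet_Iic, Set.inter_comm,
      Set.Ioi_inter_Iic]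
    exact hint
  · rw [he, MeasureTheory.setIntegral_indicator measurableSet_Iic, Set.Ioi_inter_Iic,
      ← intervalIntegral.integral_of_le h, integral_inv h0]

/-- A pole at `w ≠ 0` lies at distance `‖w‖⁻¹` from `z₀`. Exchanging the sum over poles with the
integral in `t` gives it the weight `log (r⁻¹ ‖w‖⁻¹)`. The pole at `w = 0` is the one at infinity,
matched by the term `-n(∞, f) log r`. -/
lemma counting_eq {f : ℂ → ℂ} {z₀ : ℂ} (hf : IsMeromorphic f z₀) {r : ℝ} (hr : 0 < r) :
    counting f z₀ r = ValueDistribution.logCounting (toPlane f z₀) ⊤ r⁻¹ := by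
  set D := (MeromorphicOn.divisor (toPlane f z₀) Set.univ)⁻ with hD
  have hlog : ValueDistribution.logCounting (toPlane f z₀) ⊤ r⁻¹
      = Function.locallyFinsuppWithin.logCounting D r⁻¹ := by
    rw [ValueDistribution.logCounting_top]
  set B := Function.locallyFinsuppWithin.toClosedBall r⁻¹ D with hB
  have hfin : B.support.Finite := B.finiteSupport (isCompact_closedBall 0 |r⁻¹|)
  set S : Finset ℂ := hfin.toFinset.erase 0 with hS
  have hri : |r⁻¹| = r⁻¹ := abs_of_pos (inv_pos.2 hr)
  have hmemS : ∀ w, w ∈ S ↔ w ≠ 0 ∧ ‖w‖ ≤ r⁻¹ ∧ D w ≠ 0 := by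
    intro w
    rw [hS, Finset.mem_erase, Set.Finite.mem_toFinset, Function.mem_support]
    refine and_congr_right fun hw ↦ ⟨fun h ↦ ?_, fun h ↦ ?_⟩
    · have hw' : w ∈ Metric.closedBall (0 : ℂ) |r⁻¹| :=
        Function.locallyFinsuppWithin.toClosedBall_support_subset_closedBall D h
      refine ⟨by simpa [hri] using hw', ?_⟩
      rwa [hB, Function.locallyFinsuppWithin.toClosedBall_eval_within D hw'] at h
    · rw [hB, Function.locallyFinsuppWithin.toClosedBall_eval_within D
        (by simpa [hri] using h.1)]
      exact h.2
  have hBS : ∀ w ∈ S, B w = D w := by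
    intro w hw
    rw [hB, Function.locallyFinsuppWithin.toClosedBall_eval_within D
        (by simpa [hri] using ((hmemS w).1 hw).2.1)]
  -- the logarithmic counting function as a finite sum
  have h1 : Function.locallyFinsuppWithin.logCounting D r⁻¹
      = ∑ w ∈ S, (D w : ℝ) * Real.log (r⁻¹ * ‖w‖⁻¹) + (D 0 : ℝ) * Real.log r⁻¹ := by
    change ∑ᶠ z, (B z : ℝ) * Real.log (r⁻¹ * ‖z‖⁻¹) + (D 0 : ℝ) * Real.log r⁻¹ = _
    congr 1
    rw [finsum_eq_sum_of_support_subset (s := S)]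
    · exact Finset.sum_congr rfl fun w hw ↦ by rw [hBS w hw]
    · intro w hw
      rw [Function.mem_support] at hw
      simp only [hS, Finset.coe_erase, Set.Finite.coe_toFinset, Set.mem_sdiff,
        Function.mem_support, Set.mem_singleton_iff]
      refine ⟨fun h ↦ hw (by simp [h]), fun h ↦ hw (by simp [h])⟩
  -- the pole count as a finite sum
  have h2 : ∀ t, r ≤ t → ((poleCount f z₀ t : ℝ) - (poleMultInfty f : ℝ))
      = ∑ w ∈ S, (D w : ℝ) * (if t ≤ ‖w‖⁻¹ then 1 else 0) := by
    intro t ht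
    have htpos : 0 < t := hr.trans_le ht
    have hinj : Set.InjOn (fun w : ℂ ↦ z₀ - w⁻¹) (S : Set ℂ) := fun a _ b _ hab ↦ by simpa using hab
    have h3 : ∑ᶠ z ∈ {z : ℂ | t ≤ ‖z - z₀‖}, poleMult f z
        = ∑ w ∈ S, if t ≤ ‖w‖⁻¹ then poleMult f (z₀ - w⁻¹) else 0 := by
      rw [finsum_mem_def, finsum_eq_sum_of_support_subset (s := S.image fun w ↦ z₀ - w⁻¹),
        Finset.sum_image hinj]
      · refine Finset.sum_congr rfl fun w _ ↦ ?_
        simp [Set.indicator]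
      · intro z hz
        rw [Function.mem_support, Set.indicator_apply_ne_zero] at hz
        obtain ⟨hz1, hz2⟩ := hz
        have hz1 : t ≤ ‖z - z₀‖ := hz1
        have hne : z₀ - z ≠ 0 := by
          intro h
          rw [← neg_sub, norm_neg, h, norm_zero] at hz1
          linarith
        rw [Finset.coe_image]
        refine ⟨(z₀ - z)⁻¹, ?_, by simp⟩
        rw [Finset.mem_coe, hmemS]
        refine ⟨inv_ne_zero hne, ?_, ?_⟩
        · rw [norm_inv, ← norm_neg, neg_sub]
          exact inv_anti₀ hr (ht.trans hz1)
        · rw [hD, ← poleMult_eq hf (inv_ne_zero hne)]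
          simpa using hz2
    rw [poleCount, h3]
    push_cast
    rw [add_sub_cancel_right]
    refine Finset.sum_congr rfl fun w hw ↦ ?_
    have := poleMult_eq hf ((hmemS w).1 hw).1
    rw [hD, ← this]
    split_ifs <;> simp
  rw [hlog, h1, counting]
  have hint : ∀ w ∈ S, r ≤ ‖w‖⁻¹ := by
    intro w hw
    obtain ⟨hw0, hw1, -⟩ := (hmemS w).1 hw
    exact (le_inv_comm₀ hr (norm_pos_iff.2 hw0)).2 hw1
  have h4 : ∫ t in Set.Ioi r, ((poleCount f z₀ t : ℝ) - (poleMultInfty f : ℝ)) / t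
      = ∑ w ∈ S, (D w : ℝ) * Real.log (r⁻¹ * ‖w‖⁻¹) := by
    rw [MeasureTheory.setIntegral_congr_fun (g := fun t ↦ ∑ w ∈ S, (D w : ℝ) *
      (if t ≤ ‖w‖⁻¹ then t⁻¹ else 0)) measurableSet_Ioi]
    · rw [MeasureTheory.integral_finsetSum]
      · refine Finset.sum_congr rfl fun w hw ↦ ?_
        rw [MeasureTheory.integral_const_mul, (integral_Ioi_indicator_inv hr (hint w hw)).2,
          div_eq_inv_mul]
      · intro w hw
        exact (integral_Ioi_indicator_inv hr (hint w hw)).1.const_mul _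
    · intro t ht
      simp only
      rw [h2 t (le_of_lt ht), Finset.sum_div]
      refine Finset.sum_congr rfl fun w _ ↦ ?_
      split_ifs <;> simp [div_eq_mul_inv]
  rw [h4, Real.log_inv, ← poleMultInfty_eq hf]
  push_cast
  ring

lemma characteristic_eq {f : ℂ → ℂ} {z₀ : ℂ} (hf : IsMeromorphic f z₀) {r : ℝ} (hr : 0 < r) :
    characteristic f z₀ r = ValueDistribution.characteristic (toPlane f z₀) ⊤ r⁻¹ := by
  rw [characteristic, proximity_eq, counting_eq hf hr, ValueDistribution.characteristic,
    Pi.add_apply]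

/-! ### Circle means of the inverse square root of the distance to a point -/

/-- The distance from a point of the circle of radius `R` to the nonnegative real axis is at least
proportional to the angle. -/
lemma mul_abs_div_pi_le_norm_sub {R s t : ℝ} (hR : 0 ≤ R) (hs : 0 ≤ s) (ht : |t| ≤ Real.pi) :
    R * (|t| / Real.pi) ≤ ‖(R : ℂ) * Complex.exp (t * Complex.I) - s‖ := by
  have hpi := Real.pi_pos
  have hre : ((R : ℂ) * Complex.exp (t * Complex.I) - s).re = R * Real.cos t - s := by
    simp [Complex.exp_ofReal_mul_I_re]
  have him : ((R : ℂ) * Complex.exp (t * Complex.I) - s).im = R * Real.sin t := by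
    simp [Complex.exp_ofReal_mul_I_im]
  by_cases h : |t| ≤ Real.pi / 2
  · calc R * (|t| / Real.pi) ≤ R * |Real.sin t| := by
          gcongr
          refine le_trans ?_ (Real.mul_abs_le_abs_sin h)
          rw [div_eq_mul_inv, div_eq_mul_inv, mul_comm, mul_assoc]
          have : 0 ≤ Real.pi⁻¹ * |t| := by positivity
          linarith
      _ = |((R : ℂ) * Complex.exp (t * Complex.I) - s).im| := by
          rw [him, abs_mul, abs_of_nonneg hR]
      _ ≤ _ := Complex.abs_im_le_norm _
  -- On the far half of the circle `R² - 2Rs cos t + s² ≥ R²`.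
  · have hcos : Real.cos t ≤ 0 := by
      rw [← Real.cos_abs]
      exact Real.cos_nonpos_of_pi_div_two_le_of_le (by linarith) (by linarith)
    have h1 : R * (|t| / Real.pi) ≤ R := by
      apply mul_le_of_le_one_right hR
      rwa [div_le_one hpi]
    refine h1.trans ?_
    rw [Complex.norm_def]
    apply Real.le_sqrt_of_sq_le
    rw [Complex.normSq_apply, hre, him]
    nlinarith [Real.sin_sq_add_cos_sq t, mul_nonneg (mul_nonneg hR hs) (neg_nonneg.2 hcos),
      sq_nonneg s, sq_nonneg R]

/-- Rotating by `u.arg` puts `u` on the positive ray, so the only possible singularities are at the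
two ends of the period; each summand majorises one of them. -/
lemma sqrt_inv_norm_circleMap_sub_le {R t : ℝ} (hR : 1 ≤ R) (u : ℂ)
    (ht : t ∈ Set.Ioo 0 (2 * Real.pi)) :
    √(‖circleMap 0 R (t + u.arg) - u‖⁻¹) ≤
      √Real.pi * (t ^ (-(1 / 2) : ℝ) + (2 * Real.pi - t) ^ (-(1 / 2) : ℝ)) := by
  have hpi := Real.pi_pos
  have hnorm : ∀ t : ℝ, ‖circleMap 0 R (t + u.arg) - u‖
      = ‖(R : ℂ) * Complex.exp (t * Complex.I) - (‖u‖ : ℝ)‖ := by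
    intro t
    have : circleMap 0 R (t + u.arg) - u
        = ((R : ℂ) * Complex.exp (t * Complex.I) - (‖u‖ : ℝ)) * Complex.exp (u.arg * Complex.I) := by
      rw [sub_mul, Complex.norm_mul_exp_arg_mul_I, circleMap_zero, mul_assoc, ← Complex.exp_add]
      push_cast
      ring_nf
    rw [this, norm_mul, Complex.norm_exp_ofReal_mul_I, mul_one]
  have key : ∀ s : ℝ, 0 < s → s / Real.pi ≤ ‖circleMap 0 R (t + u.arg) - u‖ →
      √(‖circleMap 0 R (t + u.arg) - u‖⁻¹) ≤ √Real.pi * s ^ (-(1 / 2) : ℝ) := by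
    intro s hs h
    rw [Real.rpow_neg hs.le, ← Real.sqrt_eq_rpow, ← Real.sqrt_inv, ← Real.sqrt_mul hpi.le]
    apply Real.sqrt_le_sqrt
    calc _ ≤ (s / Real.pi)⁻¹ := inv_anti₀ (by positivity) h
      _ = _ := by rw [inv_div, div_eq_mul_inv]
  have p1 : 0 ≤ t ^ (-(1 / 2) : ℝ) := Real.rpow_nonneg ht.1.le _
  have p2 : 0 ≤ (2 * Real.pi - t) ^ (-(1 / 2) : ℝ) := Real.rpow_nonneg (by linarith [ht.2]) _
  by_cases h : t ≤ Real.pi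
  · refine (key t ht.1 ?_).trans (by gcongr; linarith)
    rw [hnorm]
    refine le_trans ?_ (mul_abs_div_pi_le_norm_sub (by linarith) (norm_nonneg u)
      (by rwa [abs_of_pos ht.1]))
    rw [abs_of_pos ht.1]
    exact le_mul_of_one_le_left (div_nonneg ht.1.le hpi.le) hR
  · push Not at h
    have habs : |t - 2 * Real.pi| = 2 * Real.pi - t := by
      rw [abs_of_neg (by linarith [ht.2])]; ring
    refine (key (2 * Real.pi - t) (by linarith [ht.2]) ?_).trans (by gcongr; linarith)
    have hper : circleMap 0 R (t + u.arg) = circleMap 0 R (t - 2 * Real.pi + u.arg) := by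
      rw [← periodic_circleMap 0 R (t - 2 * Real.pi + u.arg)]
      congr 1
      ring
    rw [hper, hnorm]
    refine le_trans ?_ (mul_abs_div_pi_le_norm_sub (t := t - 2 * Real.pi) (by linarith)
      (norm_nonneg u) (by rw [habs]; linarith))
    rw [habs]
    exact le_mul_of_one_le_left (div_nonneg (by linarith [ht.2]) hpi.le) hR

/-- The square root keeps the singularity integrable even when `u` lies on the circle, and the bound
is uniform in `u` and `R`. The mean of the majorant is `2√2 < 3`. -/
lemma circleIntegrable_sqrt_inv_norm_sub_and_circleAverage_le {R : ℝ} (hR : 1 ≤ R) (u : ℂ) :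
    CircleIntegrable (fun w ↦ √(‖w - u‖⁻¹)) 0 R ∧
      Real.circleAverage (fun w ↦ √(‖w - u‖⁻¹)) 0 R ≤ 3 := by
  have hpi := Real.pi_pos
  set b : ℝ → ℝ := fun t ↦ √Real.pi * (t ^ (-(1 / 2) : ℝ) + (2 * Real.pi - t) ^ (-(1 / 2) : ℝ))
    with hb
  have i1 : IntervalIntegrable (fun t : ℝ ↦ t ^ (-(1 / 2) : ℝ)) MeasureTheory.volume 0
      (2 * Real.pi) := intervalIntegral.intervalIntegrable_rpow' (by norm_num)
  have i2 : IntervalIntegrable (fun t : ℝ ↦ (2 * Real.pi - t) ^ (-(1 / 2) : ℝ))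
      MeasureTheory.volume 0 (2 * Real.pi) := by
    have := (i1.comp_sub_left (2 * Real.pi)).symm
    simpa using this
  have ib : IntervalIntegrable b MeasureTheory.volume 0 (2 * Real.pi) :=
    (i1.add i2).const_mul _
  have hval : ∫ t in (0 : ℝ)..(2 * Real.pi), t ^ (-(1 / 2) : ℝ) = 2 * √(2 * Real.pi) := by
    rw [integral_rpow (Or.inl (by norm_num)), Real.sqrt_eq_rpow]
    norm_num
    ring
  have hval2 : ∫ t in (0 : ℝ)..(2 * Real.pi), (2 * Real.pi - t) ^ (-(1 / 2) : ℝ)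
      = 2 * √(2 * Real.pi) := by
    rw [intervalIntegral.integral_comp_sub_left (fun t : ℝ ↦ t ^ (-(1 / 2) : ℝ)) (2 * Real.pi)]
    simpa using hval
  have hvalb : ∫ t in (0 : ℝ)..(2 * Real.pi), b t = √2 * 4 * Real.pi := by
    rw [hb, intervalIntegral.integral_const_mul, intervalIntegral.integral_add i1 i2, hval, hval2,
      Real.sqrt_mul (by norm_num)]
    have := Real.mul_self_sqrt hpi.le
    linear_combination (4 * √2) * this
  have hmeas : Measurable fun t : ℝ ↦ √(‖circleMap 0 R (t + u.arg) - u‖⁻¹) := by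
    have : Measurable fun t : ℝ ↦ circleMap 0 R (t + u.arg) := by fun_prop
    fun_prop
  have ishift : IntervalIntegrable (fun t : ℝ ↦ √(‖circleMap 0 R (t + u.arg) - u‖⁻¹))
      MeasureTheory.volume 0 (2 * Real.pi) := by
    rw [intervalIntegrable_iff_integrableOn_Ioo_of_le (by positivity)] at ib ⊢
    refine MeasureTheory.Integrable.mono' ib hmeas.aestronglyMeasurable ?_
    refine (MeasureTheory.ae_restrict_iff' measurableSet_Ioo).2 (Eventually.of_forall fun t ht ↦ ?_)
    rw [Real.norm_of_nonneg (Real.sqrt_nonneg _)]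
    exact sqrt_inv_norm_circleMap_sub_le hR u ht
  constructor
  · have hper : Function.Periodic (fun t : ℝ ↦ √(‖circleMap 0 R t - u‖⁻¹)) (2 * Real.pi) :=
      fun t ↦ by simp only [periodic_circleMap 0 R t]
    have h := ishift.comp_sub_right u.arg
    simp only [sub_add_cancel] at h
    refine hper.intervalIntegrable (t := 0 + u.arg) (by positivity) ?_ 0 (2 * Real.pi)
    convert! h using 1
    ring
  · rw [Real.circleAverage_eq_integral_add u.arg, smul_eq_mul, inv_mul_le_iff₀ (by positivity)]
    calc _ ≤ ∫ t in (0 : ℝ)..(2 * Real.pi), b t :=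
          intervalIntegral.integral_mono_on_of_le_Ioo (by positivity) ishift ib
            fun t ht ↦ sqrt_inv_norm_circleMap_sub_le hR u ht
      _ = √2 * 4 * Real.pi := hvalb
      _ ≤ 2 * Real.pi * 3 := by
          have : √2 ≤ 3 / 2 := by
            rw [Real.sqrt_le_left (by norm_num)]
            norm_num
          nlinarith

/-! ### Splitting off zeros and poles in a disc -/

/-- The logarithmic derivative of a zero-free analytic function is controlled by the mean of
`|log ‖G‖|` over a larger circle. -/
lemma norm_logDeriv_le_circleAverage_abs_log {G : ℂ → ℂ} {ρ : ℝ} {w : ℂ}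
    (hG : AnalyticOnNhd ℂ G (Metric.closedBall 0 ρ)) (hG0 : ∀ z ∈ Metric.closedBall 0 ρ, G z ≠ 0)
    (hw : w ∈ Metric.ball 0 ρ) :
    ‖logDeriv G w‖ ≤ 2 * ρ / (ρ - ‖w‖) ^ 2
      * Real.circleAverage (fun ζ ↦ |Real.log ‖G ζ‖|) 0 ρ := by
  have hρ : 0 < ρ := Metric.pos_of_mem_ball hw
  have hwρ : ‖w‖ < ρ := by simpa using hw
  have hharm : InnerProductSpace.HarmonicOnNhd (fun z ↦ Real.log ‖G z‖) (Metric.closedBall 0 ρ) :=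
    fun z hz ↦ (hG z hz).harmonicAt_log_norm (hG0 z hz)
  have hint : CircleIntegrable (fun z ↦ Real.log ‖G z‖) 0 ρ := by
    apply MeromorphicOn.circleIntegrable_log_norm
    rw [abs_of_pos hρ]
    exact (hG.mono Metric.sphere_subset_closedBall).meromorphicOn
  have hintC : CircleIntegrable (fun z ↦ (Real.log ‖G z‖ : ℂ)) 0 ρ := by
    simp only [CircleIntegrable, intervalIntegrable_iff] at hint ⊢
    exact Complex.ofRealCLM.integrable_comp hint
  -- `S` is a holomorphic function with real part `log ‖G‖`, hence a logarithm of `G` up to an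
  -- imaginary constant. `S'` comes from differentiating the kernel `(ζ + w)/(ζ - w)` in `w`.
  set S : ℂ → ℂ := fun w ↦ Real.circleAverage
    (fun ζ ↦ herglotzRieszKernel 0 w ζ • (Real.log ‖G ζ‖ : ℂ)) 0 ρ with hS
  set S' : ℂ → ℂ := fun w ↦ Real.circleAverage
    (fun ζ ↦ (2 * ζ / (ζ - w) ^ 2) • (Real.log ‖G ζ‖ : ℂ)) 0 ρ with hS'
  have hder : ∀ v ∈ Metric.ball (0 : ℂ) ρ, HasDerivAt S (S' v) v := fun v hv ↦
    hasDerivAt_circleAverage_herglotzRieszKernel_smul hintC hv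
  have hre : ∀ v ∈ Metric.ball (0 : ℂ) ρ, (S v).re = Real.log ‖G v‖ := fun v hv ↦ by
    rw [hS, re_circleAverage_herglotzRieszKernel_smul hint hv]
    exact hharm.circleAverage_re_herglotzRieszKernel_smul hv
  -- `G exp (-S)` has modulus one, hence is constant
  set F : ℂ → ℂ := fun v ↦ G v * Complex.exp (-S v) with hF
  have hGd : ∀ v ∈ Metric.ball (0 : ℂ) ρ, DifferentiableAt ℂ G v := fun v hv ↦
    (hG v (Metric.ball_subset_closedBall hv)).differentiableAt
  have hFd : ∀ v ∈ Metric.ball (0 : ℂ) ρ, HasDerivAt F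
      (deriv G v * Complex.exp (-S v) + G v * (Complex.exp (-S v) * (-S' v))) v := fun v hv ↦
    (hGd v hv).hasDerivAt.mul ((hder v hv).neg.cexp)
  have hFn : ∀ v ∈ Metric.ball (0 : ℂ) ρ, ‖F v‖ = 1 := fun v hv ↦ by
    have hpos : 0 < ‖G v‖ := norm_pos_iff.2 (hG0 v (Metric.ball_subset_closedBall hv))
    rw [hF, norm_mul, Complex.norm_exp, Complex.neg_re, hre v hv, Real.exp_neg,
      Real.exp_log hpos, mul_inv_cancel₀ hpos.ne']
  have hconst := Complex.eqOn_of_isPreconnected_of_isMaxOn_norm (f := F)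
    (Metric.isPreconnected_ball) Metric.isOpen_ball
    (fun v hv ↦ (hFd v hv).differentiableAt.differentiableWithinAt)
    (Metric.mem_ball_self hρ) (fun v hv ↦ by
      simp [hFn v hv, hFn 0 (Metric.mem_ball_self hρ)])
  have hF0 : deriv F w = 0 := by
    rw [Filter.EventuallyEq.deriv_eq (hconst.eventuallyEq_of_mem (Metric.isOpen_ball.mem_nhds hw))]
    exact deriv_const _ _
  rw [(hFd w hw).deriv] at hF0
  have hlog : logDeriv G w = S' w := by
    have h0 : G w ≠ 0 := hG0 w (Metric.ball_subset_closedBall hw)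
    have hexp : Complex.exp (-S w) ≠ 0 := Complex.exp_ne_zero _
    rw [logDeriv_apply, div_eq_iff h0]
    apply mul_right_cancel₀ hexp
    linear_combination hF0
  rw [hlog, hS']
  simp only [Real.circleAverage_def]
  rw [norm_smul, smul_eq_mul, Real.norm_of_nonneg (by positivity)]
  have hpi := Real.pi_pos
  rw [mul_left_comm]
  gcongr
  rw [← intervalIntegral.integral_const_mul]
  refine intervalIntegral.norm_integral_le_of_norm_le (by positivity)
    (Eventually.of_forall fun θ _ ↦ ?_) ?_
  · rw [norm_smul, norm_div, norm_mul, norm_pow, norm_circleMap_zero, abs_of_pos hρ,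
      Complex.norm_real, Real.norm_eq_abs]
    have h1 : ‖(2 : ℂ)‖ = 2 := by norm_num
    rw [h1]
    have h2 : ρ - ‖w‖ ≤ ‖circleMap 0 ρ θ - w‖ := by
      have := norm_sub_norm_le (circleMap 0 ρ θ) w
      rwa [norm_circleMap_zero, abs_of_pos hρ] at this
    have h3 : 0 < ρ - ‖w‖ := by linarith
    gcongr
  · exact (IntervalIntegrable.abs hint).const_mul _

/-- By compactness `g` has finitely many zeros and poles in the disc; dividing them out leaves the
zero-free factor `G`, and products become sums. The identities hold off a discrete set, which is
enough for circle means. -/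
lemma exists_logDeriv_decomposition {g : ℂ → ℂ} (hg : Meromorphic g)
    (hg' : ∀ u, meromorphicOrderAt g u ≠ ⊤) (ρ : ℝ) :
    ∃ (S : Finset ℂ) (G : ℂ → ℂ),
      (∀ u, u ∈ S ↔ MeromorphicOn.divisor g Set.univ u ≠ 0 ∧ ‖u‖ ≤ ρ) ∧
      AnalyticOnNhd ℂ G (Metric.closedBall 0 ρ) ∧ (∀ z ∈ Metric.closedBall 0 ρ, G z ≠ 0) ∧
      (fun z ↦ Real.log ‖g z‖) =ᶠ[codiscreteWithin (Metric.closedBall 0 ρ)]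
        (fun z ↦ ∑ u ∈ S, (MeromorphicOn.divisor g Set.univ u : ℝ) * Real.log ‖z - u‖
          + Real.log ‖G z‖) ∧
      logDeriv g =ᶠ[codiscreteWithin (Metric.closedBall 0 ρ)]
        (fun z ↦ ∑ u ∈ S, (MeromorphicOn.divisor g Set.univ u : ℂ) * (z - u)⁻¹
          + logDeriv G z) := by
  set U : Set ℂ := Metric.closedBall 0 ρ with hU
  set D := MeromorphicOn.divisor g U with hD
  have hDfin : D.support.Finite := D.finiteSupport (isCompact_closedBall 0 ρ)
  obtain ⟨G, hG, hG0, hgG⟩ := hg.meromorphicOn.extract_zeros_poles (U := U)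
    (fun u ↦ hg' u) hDfin
  have hDu : ∀ u ∈ U, D u = MeromorphicOn.divisor g Set.univ u := fun u hu ↦ by
    rw [hD, MeromorphicOn.divisor_apply hg.meromorphicOn hu,
      MeromorphicOn.divisor_apply hg.meromorphicOn (Set.mem_univ u)]
  have hS : ∀ u ∈ hDfin.toFinset, u ∈ U := fun u hu ↦
    D.supportWithinDomain (by simpa using hu)
  have hDS : ∀ u ∈ hDfin.toFinset, D u = MeromorphicOn.divisor g Set.univ u :=
    fun u hu ↦ hDu u (hS u hu)
  refine ⟨hDfin.toFinset, G, fun u ↦ ⟨fun h ↦ ⟨?_, ?_⟩, fun h ↦ ?_⟩, hG, fun z hz ↦ hG0 ⟨z, hz⟩,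
    ?_, ?_⟩
  · rw [← hDS u h]
    simpa using h
  · simpa [hU] using hS u h
  · rw [Set.Finite.mem_toFinset, Function.mem_support, hDu u (by simpa [hU] using h.2)]
    exact h.1
  · filter_upwards [MeromorphicOn.extract_zeros_poles_log hG0 hgG] with z hz
    rw [hz, Pi.add_apply, finsum_eq_sum_of_support_subset (s := hDfin.toFinset), Finset.sum_apply]
    · congr 1
      exact Finset.sum_congr rfl fun u hu ↦ by rw [hDS u hu]
    · intro u hu
      simp only [Set.Finite.coe_toFinset, Function.mem_support]
      rintro h
      exact hu (by ext; simp [← hD, h])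
  · have hGm : MeromorphicOn G U := hG.meromorphicOn
    set P : ℂ → ℂ := ∏ᶠ u, (fun x ↦ x - u) ^ D u with hP
    have hPm : MeromorphicOn P U := (Function.FactorizedRational.meromorphicNFOn D U).meromorphicOn
    have hgG' : g =ᶠ[codiscreteWithin U] P * G := hgG
    have h1 := MeromorphicOn.deriv_eventuallyEq_codiscreteWithin hg.meromorphicOn
      (hPm.mul hGm) hgG'
    have h2 := MeromorphicOn.logDeriv_mul_eventuallyEq hPm hGm
      (fun x _ ↦ Function.FactorizedRational.meromorphicOrderAt_ne_top D) (fun x hx ↦ by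
        rw [(hG x hx).meromorphicOrderAt_eq, (hG x hx).analyticOrderAt_eq_zero.2 (hG0 ⟨x, hx⟩)]
        simp)
    have h3 := MeromorphicOn.logDeriv_finprod_zpow_eventuallyEq (U := U) (d := D)
      (F := fun u x ↦ x - u) hDfin
      (fun u ↦ (analyticOnNhd_id.sub analyticOnNhd_const).meromorphicOn) (fun u x _ ↦ by
        have : AnalyticAt ℂ (fun x ↦ x - u) x := analyticAt_id.sub analyticAt_const
        rw [meromorphicOrderAt_ne_top_iff_eventually_ne_zero this.meromorphicAt]
        by_cases hxu : x = u
        · subst hxu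
          filter_upwards [self_mem_nhdsWithin] with y hy using sub_ne_zero.2 hy
        · exact nhdsWithin_le_nhds ((this.continuousAt).eventually_ne (sub_ne_zero.2 hxu)))
    filter_upwards [hgG', h1, h2, h3] with z z0 z1 z2 z3
    rw [logDeriv_apply, z0, z1, ← logDeriv_apply, z2, Pi.add_apply, hP, z3,
      finsum_eq_sum_of_support_subset (s := hDfin.toFinset)]
    · congr 1
      refine Finset.sum_congr rfl fun u hu ↦ ?_
      rw [hDS u hu, logDeriv_apply, zsmul_eq_mul]
      congr 1
      simp
    · intro u hu
      simp only [Set.Finite.coe_toFinset, Function.mem_support]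
      rintro h
      exact hu (by simp [h])

/-- The number of points of a nonnegative divisor in a disc is controlled by its logarithmic
counting function at twice the radius. -/
lemma sum_mul_log_two_le_logCounting {E : Function.locallyFinsupp ℂ ℤ} (hE : 0 ≤ E) {r : ℝ}
    (hr : 1 ≤ r) (S : Finset ℂ) (hS : ∀ u ∈ S, ‖u‖ ≤ r) :
    (∑ u ∈ S, (E u : ℝ)) * Real.log 2
      ≤ Function.locallyFinsuppWithin.logCounting E (2 * r) := by
  have hr0 : 0 < r := by linarith
  set B := Function.locallyFinsuppWithin.toClosedBall (2 * r) E with hB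
  have habs : |2 * r| = 2 * r := abs_of_pos (by linarith)
  have hfin : B.support.Finite := B.finiteSupport (isCompact_closedBall 0 |2 * r|)
  -- Since `Real.log 0 = 0`, the summand at the origin is `B 0 * log (2r)`, so the separate central
  -- term is absorbed into the sum. Each point of norm at most `r` then has weight at least `log 2`.
  have hlc : Function.locallyFinsuppWithin.logCounting E (2 * r)
      = ∑ᶠ z, (B z : ℝ) * (Real.log (2 * r) - Real.log ‖0 - z‖) := by
    rw [countingFunction_finsum_eq_finsum_add (by linarith) hfin]
    simp only [zero_sub, norm_neg]
    rw [hB, Function.locallyFinsuppWithin.toClosedBall_eval_within E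
      (by simp)]
    rfl
  have hpos : ∀ z, 0 ≤ (B z : ℝ) * (Real.log (2 * r) - Real.log ‖0 - z‖) := by
    intro z
    by_cases hz : z ∈ Metric.closedBall (0 : ℂ) |2 * r|
    · rw [hB, Function.locallyFinsuppWithin.toClosedBall_eval_within E hz]
      refine mul_nonneg (Int.cast_nonneg (hE z)) (sub_nonneg.2 ?_)
      by_cases h0 : z = 0
      · simp only [h0, sub_zero, norm_zero, Real.log_zero]
        exact Real.log_nonneg (by linarith)
      · rw [habs, mem_closedBall_zero_iff] at hz
        rw [zero_sub, norm_neg]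
        exact Real.log_le_log (norm_pos_iff.2 h0) hz
    · rw [Function.locallyFinsuppWithin.apply_eq_zero_of_notMem _ hz]
      simp
  rw [hlc, finsum_eq_sum_of_support_subset (s := S ∪ hfin.toFinset), Finset.sum_mul]
  · refine (Finset.sum_le_sum fun u hu ↦ ?_).trans
      (Finset.sum_le_sum_of_subset_of_nonneg Finset.subset_union_left fun u _ _ ↦ hpos u)
    have hu' := hS u hu
    rw [hB, Function.locallyFinsuppWithin.toClosedBall_eval_within E
      (by rw [habs, mem_closedBall_zero_iff]; linarith)]
    refine mul_le_mul_of_nonneg_left ?_ (Int.cast_nonneg (hE u))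
    rw [Real.log_mul two_ne_zero hr0.ne']
    suffices Real.log ‖0 - u‖ ≤ Real.log r by linarith
    by_cases h0 : u = 0
    · simp only [h0, sub_zero, norm_zero, Real.log_zero]
      exact Real.log_nonneg hr
    · rw [zero_sub, norm_neg]
      exact Real.log_le_log (norm_pos_iff.2 h0) hu'
  · intro u hu
    rw [Finset.coe_union, Set.Finite.coe_toFinset]
    right
    intro h
    exact hu (by simp only [h]; simp)

/-! ### Means of the individual pieces of the logarithmic derivative -/

lemma abs_log_eq_posLog_add (x : ℝ) : |Real.log x| = Real.posLog x + Real.posLog x⁻¹ := by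
  have h1 := Real.half_mul_log_add_log_abs (x := x)
  have h2 := Real.posLog_sub_posLog_inv (x := x)
  linarith

lemma circleIntegrable_log_norm_sub (u : ℂ) (ρ : ℝ) :
    CircleIntegrable (fun ζ ↦ Real.log ‖ζ - u‖) 0 ρ := by
  apply MeromorphicOn.circleIntegrable_log_norm
  exact (analyticOnNhd_id.sub analyticOnNhd_const).meromorphicOn

/-- Write `|log x| = 2 log⁺ x - log x`. The first term is at most `2 log (2ρ)` on the circle, and
`log ‖ζ - u‖` has mean `log ρ ≥ 0`. -/
lemma circleAverage_abs_log_norm_sub_le {ρ : ℝ} (hρ : 1 ≤ ρ) {u : ℂ} (hu : ‖u‖ ≤ ρ) :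
    Real.circleAverage (fun ζ ↦ |Real.log ‖ζ - u‖|) 0 ρ ≤ 2 * Real.log (2 * ρ) := by
  have hint := circleIntegrable_log_norm_sub u ρ
  have habs : |ρ| = ρ := abs_of_pos (by linarith)
  have h1 : Real.circleAverage (fun ζ ↦ |Real.log ‖ζ - u‖|) 0 ρ
      ≤ Real.circleAverage (fun ζ ↦ 2 * Real.log (2 * ρ) - Real.log ‖ζ - u‖) 0 ρ := by
    refine Real.circleAverage_mono hint.abs ((circleIntegrable_const _ _ _).sub hint) fun ζ hζ ↦ ?_
    have hζ : ‖ζ‖ = ρ := by simpa [habs] using hζ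
    have h2 := Real.half_mul_log_add_log_abs (x := ‖ζ - u‖)
    have h3 : Real.posLog ‖ζ - u‖ ≤ Real.posLog (2 * ρ) := by
      refine Real.posLog_le_posLog (norm_nonneg _) ?_
      linarith [norm_sub_le ζ u]
    rw [Real.posLog_eq_log (x := 2 * ρ) (by rw [abs_of_pos] <;> linarith)] at h3
    linarith
  refine h1.trans ?_
  rw [Real.circleAverage_fun_sub (circleIntegrable_const _ _ _) hint, Real.circleAverage_const,
    circleAverage_log_norm_sub_const_of_mem_closedBall (by simpa [habs] using hu)]
  linarith [Real.log_nonneg hρ]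

/-- Mean value of `log (1 + X)`, in the form of a tangent line bound. -/
lemma log_one_add_le_tangent {X a : ℝ} (hX : 0 ≤ X) (ha : 0 ≤ a) :
    Real.log (1 + X) ≤ Real.log (1 + a) + (1 + a)⁻¹ * (X - a) := by
  have h1 : (0 : ℝ) < 1 + a := by linarith
  have h2 : (0 : ℝ) < 1 + X := by linarith
  have := Real.log_le_sub_one_of_pos (div_pos h2 h1)
  rw [Real.log_div h2.ne' h1.ne'] at this
  have h3 : (1 + X) / (1 + a) - 1 = (1 + a)⁻¹ * (X - a) := by field_simp; ring
  linarith

/-- Passing to square roots replaces the poles by a sum with finite circle mean. It uses `|d| ≤ d²`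
for integers and `∑ x² ≤ (∑ x)²` for nonnegative terms. -/
lemma posLog_norm_sum_div_le (S : Finset ℂ) (d : ℂ → ℤ) (z : ℂ) :
    Real.posLog ‖∑ u ∈ S, (d u : ℂ) * (z - u)⁻¹‖
      ≤ 2 * Real.log (1 + ∑ u ∈ S, |(d u : ℝ)| * √(‖z - u‖⁻¹)) := by
  set X := ∑ u ∈ S, |(d u : ℝ)| * √(‖z - u‖⁻¹) with hX
  have hX0 : 0 ≤ X := Finset.sum_nonneg fun u _ ↦ by positivity
  have h1 : ‖∑ u ∈ S, (d u : ℂ) * (z - u)⁻¹‖ ≤ X ^ 2 := by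
    calc _ ≤ ∑ u ∈ S, |(d u : ℝ)| * ‖z - u‖⁻¹ := by
          refine (norm_sum_le _ _).trans_eq (Finset.sum_congr rfl fun u _ ↦ ?_)
          rw [norm_mul, norm_inv, Complex.norm_intCast]
      _ ≤ ∑ u ∈ S, (|(d u : ℝ)| * √(‖z - u‖⁻¹)) ^ 2 := by
          refine Finset.sum_le_sum fun u _ ↦ ?_
          rw [mul_pow, Real.sq_sqrt (by positivity)]
          refine mul_le_mul_of_nonneg_right ?_ (by positivity)
          rw [← Int.cast_abs, ← Int.cast_pow]
          exact_mod_cast Int.le_self_sq _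
      _ ≤ X ^ 2 := Finset.sum_sq_le_sq_sum_of_nonneg (fun u _ ↦ by positivity)
  calc _ ≤ Real.posLog ((1 + X) ^ 2) := Real.posLog_le_posLog (norm_nonneg _) (by nlinarith)
    _ = 2 * Real.log (1 + X) := by
        rw [Real.posLog_pow, Real.posLog_eq_log (by rw [abs_of_pos] <;> linarith)]
        norm_num

lemma proximity_le_characteristic (g : ℂ → ℂ) {R : ℝ} (hR : 1 ≤ R) :
    ValueDistribution.proximity g ⊤ R ≤ ValueDistribution.characteristic g ⊤ R := by
  rw [ValueDistribution.characteristic, Pi.add_apply]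
  linarith [ValueDistribution.logCounting_nonneg (f := g) (e := ⊤) hR]

lemma logCounting_le_characteristic (g : ℂ → ℂ) (R : ℝ) :
    ValueDistribution.logCounting g ⊤ R ≤ ValueDistribution.characteristic g ⊤ R := by
  rw [ValueDistribution.characteristic, Pi.add_apply]
  have := ValueDistribution.proximity_nonneg (f := g) (a := ⊤) R
  simp only [Pi.zero_apply] at this
  linarith

lemma circleAverage_abs_log_norm {g : ℂ → ℂ} (hg : Meromorphic g) (R : ℝ) :
    Real.circleAverage (fun z ↦ |Real.log ‖g z‖|) 0 R
      = ValueDistribution.proximity g ⊤ R + ValueDistribution.proximity g⁻¹ ⊤ R := by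
  rw [ValueDistribution.proximity_top, ValueDistribution.proximity_top,
    ← Real.circleAverage_fun_add hg.meromorphicOn.circleIntegrable_posLog_norm
      hg.inv.meromorphicOn.circleIntegrable_posLog_norm]
  congr 1
  ext z
  simp [abs_log_eq_posLog_add]

/-- Mean of `|log ‖G‖|` for a function that differs from `g` by finitely many linear factors. -/
lemma circleAverage_abs_log_le {g G : ℂ → ℂ} (hg : Meromorphic g) {ρ : ℝ} (hρ : 1 ≤ ρ)
    (S : Finset ℂ) (d : ℂ → ℤ) (hS : ∀ u ∈ S, ‖u‖ ≤ ρ)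
    (h : (fun z ↦ Real.log ‖g z‖) =ᶠ[codiscreteWithin (Metric.closedBall 0 ρ)]
      (fun z ↦ ∑ u ∈ S, (d u : ℝ) * Real.log ‖z - u‖ + Real.log ‖G z‖)) :
    Real.circleAverage (fun z ↦ |Real.log ‖G z‖|) 0 ρ
      ≤ ValueDistribution.proximity g ⊤ ρ + ValueDistribution.proximity g⁻¹ ⊤ ρ
        + (∑ u ∈ S, |(d u : ℝ)|) * (2 * Real.log (2 * ρ)) := by
  have habs : |ρ| = ρ := abs_of_pos (by linarith)
  have hgint : CircleIntegrable (fun z ↦ Real.log ‖g z‖) 0 ρ :=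
    hg.meromorphicOn.circleIntegrable_log_norm
  have hterm : ∀ u ∈ S, CircleIntegrable (fun z ↦ (d u : ℝ) * Real.log ‖z - u‖) 0 ρ :=
    fun u _ ↦ (circleIntegrable_log_norm_sub u ρ).const_fun_smul (a := (d u : ℝ))
  have hterm' : ∀ u ∈ S, CircleIntegrable (fun z ↦ |(d u : ℝ)| * |Real.log ‖z - u‖|) 0 ρ :=
    fun u _ ↦ (circleIntegrable_log_norm_sub u ρ).abs.const_fun_smul (a := |(d u : ℝ)|)
  have hsum : CircleIntegrable (fun z ↦ ∑ u ∈ S, (d u : ℝ) * Real.log ‖z - u‖) 0 ρ := by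
    convert CircleIntegrable.sum S hterm using 1
    ext z; simp
  have hsum' : CircleIntegrable (fun z ↦ ∑ u ∈ S, |(d u : ℝ)| * |Real.log ‖z - u‖|) 0 ρ := by
    convert CircleIntegrable.sum S hterm' using 1
    ext z; simp
  have h1 : Real.circleAverage (fun z ↦ |Real.log ‖G z‖|) 0 ρ
      = Real.circleAverage (fun z ↦ |Real.log ‖g z‖ - ∑ u ∈ S, (d u : ℝ) * Real.log ‖z - u‖|)
        0 ρ := by
    apply Real.circleAverage_congr_codiscreteWithin _ (by linarith)
    rw [habs]
    filter_upwards [codiscreteWithin_mono Metric.sphere_subset_closedBall h] with z hz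
    rw [hz]
    congr 1
    ring
  rw [h1]
  calc _ ≤ Real.circleAverage (fun z ↦ |Real.log ‖g z‖|
        + ∑ u ∈ S, |(d u : ℝ)| * |Real.log ‖z - u‖|) 0 ρ := by
        refine Real.circleAverage_mono (hgint.sub hsum).abs (hgint.abs.add hsum') fun z _ ↦ ?_
        refine (abs_sub _ _).trans ?_
        gcongr
        exact (Finset.abs_sum_le_sum_abs _ _).trans_eq
          (Finset.sum_congr rfl fun u _ ↦ abs_mul _ _)
    _ = (ValueDistribution.proximity g ⊤ ρ + ValueDistribution.proximity g⁻¹ ⊤ ρ)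
        + ∑ u ∈ S, |(d u : ℝ)| * Real.circleAverage (fun z ↦ |Real.log ‖z - u‖|) 0 ρ := by
        have hgabs : CircleIntegrable (fun z ↦ |Real.log ‖g z‖|) 0 ρ := hgint.abs
        rw [Real.circleAverage_fun_add hgabs hsum', circleAverage_abs_log_norm hg,
          Real.circleAverage_fun_sum hterm']
        congr 1
        refine Finset.sum_congr rfl fun u _ ↦ ?_
        exact Real.circleAverage_fun_smul (a := |(d u : ℝ)|)
    _ ≤ _ := by
        rw [Finset.sum_mul]
        gcongr with u hu
        exact circleAverage_abs_log_norm_sub_le hρ (hS u hu)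

/-- Proximity of a function dominated by a sum of simple poles plus a bounded term. -/
lemma proximity_le_of_sum_simple_poles {h L : ℂ → ℂ} (hh : Meromorphic h) {R M : ℝ} (hR : 1 ≤ R)
    (S : Finset ℂ) (d : ℂ → ℤ) (hM : ∀ z ∈ Metric.sphere 0 R, ‖L z‖ ≤ M)
    (heq : h =ᶠ[codiscreteWithin (Metric.sphere 0 R)]
      (fun z ↦ ∑ u ∈ S, (d u : ℂ) * (z - u)⁻¹ + L z)) :
    ValueDistribution.proximity h ⊤ R
      ≤ Real.log 2 + Real.posLog M + 2 * Real.log (1 + 3 * ∑ u ∈ S, |(d u : ℝ)|) := by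
  have habs : |R| = R := abs_of_pos (by linarith)
  set n := ∑ u ∈ S, |(d u : ℝ)| with hn
  have hn0 : 0 ≤ n := Finset.sum_nonneg fun u _ ↦ abs_nonneg _
  set X : ℂ → ℝ := fun z ↦ ∑ u ∈ S, |(d u : ℝ)| * √(‖z - u‖⁻¹) with hX
  have hX0 : ∀ z, 0 ≤ X z := fun z ↦ Finset.sum_nonneg fun u _ ↦ by positivity
  have hterm : ∀ u ∈ S, CircleIntegrable (fun z ↦ |(d u : ℝ)| * √(‖z - u‖⁻¹)) 0 R :=
    fun u _ ↦ (circleIntegrable_sqrt_inv_norm_sub_and_circleAverage_le hR u).1.const_fun_smul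
      (a := |(d u : ℝ)|)
  have hXint : CircleIntegrable X 0 R := by
    convert CircleIntegrable.sum S hterm using 1
    ext z; simp [hX]
  have hXavg : Real.circleAverage X 0 R ≤ 3 * n := by
    rw [hX, Real.circleAverage_fun_sum hterm, hn, mul_comm, Finset.sum_mul]
    refine Finset.sum_le_sum fun u _ ↦ ?_
    have := Real.circleAverage_fun_smul (a := |(d u : ℝ)|) (f := fun z ↦ √(‖z - u‖⁻¹)) (c := 0)
      (R := R)
    simp only [smul_eq_mul] at this
    rw [this]
    gcongr
    exact (circleIntegrable_sqrt_inv_norm_sub_and_circleAverage_le hR u).2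
  -- Jensen's inequality by a tangent line: `log (1 + X)` is replaced by its tangent at `3n`, the
  -- bound for the mean of `X`. The constant `c` is chosen so that averaging yields exactly the
  -- claimed bound.
  set c : ℝ := Real.log 2 + Real.posLog M + 2 * Real.log (1 + 3 * n)
    - 2 * (1 + 3 * n)⁻¹ * (3 * n) with hc
  have hRint : CircleIntegrable (fun z ↦ (2 * (1 + 3 * n)⁻¹) * X z) 0 R :=
    hXint.const_fun_smul (a := 2 * (1 + 3 * n)⁻¹)
  have hbd : ∀ᶠ z in codiscreteWithin (Metric.sphere (0 : ℂ) R),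
      Real.posLog ‖h z‖ ≤ c + (2 * (1 + 3 * n)⁻¹) * X z := by
    filter_upwards [heq, self_mem_codiscreteWithin (Metric.sphere (0 : ℂ) R)] with z hz hzR
    rw [hz]
    have h1 := Real.posLog_norm_add_le (∑ u ∈ S, (d u : ℂ) * (z - u)⁻¹) (L z)
    have h2 := posLog_norm_sum_div_le S d z
    have h3 : Real.posLog ‖L z‖ ≤ Real.posLog M :=
      Real.posLog_le_posLog (norm_nonneg _) (hM z hzR)
    have h4 := log_one_add_le_tangent (hX0 z) (a := 3 * n) (by positivity)
    rw [hc]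
    simp only [hX] at h4 ⊢
    nlinarith
  have hpint : CircleIntegrable (fun z ↦ Real.posLog ‖h z‖) 0 R :=
    hh.meromorphicOn.circleIntegrable_posLog_norm
  have hmax : Real.circleAverage (fun z ↦ Real.posLog ‖h z‖) 0 R
      ≤ Real.circleAverage (fun z ↦ c + (2 * (1 + 3 * n)⁻¹) * X z) 0 R := by
    have hint2 : CircleIntegrable (fun z ↦ c + (2 * (1 + 3 * n)⁻¹) * X z) 0 R :=
      (circleIntegrable_const _ _ _).add hRint
    -- The inequality is known only off a discrete set; there the difference equals its absolute
    -- value, which is nonnegative everywhere and has the same mean.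
    rw [← sub_nonneg, ← Real.circleAverage_fun_sub hint2 hpint,
      Real.circleAverage_congr_codiscreteWithin
        (f₂ := fun z ↦ |(c + (2 * (1 + 3 * n)⁻¹) * X z) - Real.posLog ‖h z‖|) _ (by linarith)]
    · exact Real.circleAverage_nonneg_of_nonneg fun z _ ↦ abs_nonneg _
    · rw [habs]
      filter_upwards [hbd] with z hz
      rw [abs_of_nonneg (sub_nonneg.2 hz)]
  rw [ValueDistribution.proximity_top]
  refine hmax.trans ?_
  rw [Real.circleAverage_fun_add (circleIntegrable_const _ _ _) hRint, Real.circleAverage_const]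
  have := Real.circleAverage_fun_smul (a := 2 * (1 + 3 * n)⁻¹) (f := X) (c := 0) (R := R)
  simp only [smul_eq_mul] at this
  rw [this, hc]
  have h5 : 2 * (1 + 3 * n)⁻¹ * Real.circleAverage X 0 R ≤ 2 * (1 + 3 * n)⁻¹ * (3 * n) := by
    gcongr
  linarith

lemma deriv_eq_logDeriv_mul_codiscrete {g : ℂ → ℂ} (hg : Meromorphic g) :
    deriv g =ᶠ[codiscrete ℂ] logDeriv g * g := by
  by_cases h : ∃ u, meromorphicOrderAt g u = ⊤
  · obtain ⟨u, hu⟩ := h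
    have h0 := hg.eventuallyEq_zero_codiscrete hu
    have h1 := MeromorphicOn.deriv_eventuallyEq_codiscreteWithin (U := Set.univ) hg.meromorphicOn
      (MeromorphicOn.const 0) h0
    filter_upwards [h0, h1] with z z0 z1
    rw [z1, Pi.mul_apply, z0]
    simp
  · push Not at h
    filter_upwards [hg.meromorphicOn.eventually_codiscreteWithin_apply_ne_zero (U := Set.univ)
      (fun u _ ↦ h u)] with z hz
    rw [Pi.mul_apply, logDeriv_apply, div_mul_cancel₀ _ hz]

lemma exists_characteristic_inv_le {g : ℂ → ℂ} (hg : Meromorphic g) :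
    ∃ C, 0 ≤ C ∧ ∀ R, |ValueDistribution.characteristic g ⊤ R
      - ValueDistribution.characteristic g⁻¹ ⊤ R| ≤ C :=
  ⟨_, le_max_of_le_left (abs_nonneg _),
    fun _ ↦ ValueDistribution.characteristic_sub_characteristic_inv_le hg⟩

/-! ### The lemma on the logarithmic derivative -/

/-- Proximity of the logarithmic derivative, for a function that does not vanish identically. -/
lemma proximity_logDeriv_le_aux {g : ℂ → ℂ} (hg : Meromorphic g)
    (hg' : ∀ u, meromorphicOrderAt g u ≠ ⊤) {C R : ℝ} (hR : 1 ≤ R)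
    (hC : ∀ R, |ValueDistribution.characteristic g ⊤ R
      - ValueDistribution.characteristic g⁻¹ ⊤ R| ≤ C) :
    ∃ n : ℝ, 0 ≤ n ∧ n * Real.log 2 ≤ 2 * ValueDistribution.characteristic g ⊤ (4 * R) + C ∧
      ValueDistribution.proximity (logDeriv g) ⊤ R ≤ Real.log 2
        + Real.posLog (4 * (2 * ValueDistribution.characteristic g ⊤ (4 * R) + C
          + n * (2 * Real.log (4 * R)))) + 2 * Real.log (1 + 3 * n) := by
  set T := ValueDistribution.characteristic g ⊤ (4 * R) with hT
  set D := MeromorphicOn.divisor g Set.univ with hD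
  -- Three radii: estimating `G'/G` on `‖z‖ = R` needs the factorisation on a larger disc, here
  -- `2R`, and counting the zeros and poles in that disc needs `N` at `4R`.
  obtain ⟨S, G, hS, hG, hG0, hlog, hld⟩ := exists_logDeriv_decomposition hg hg' (2 * R)
  have hR2 : 1 ≤ 2 * R := by linarith
  have hinv := fun r ↦ abs_le.1 (hC r)
  have hmono : ValueDistribution.characteristic g ⊤ (2 * R) ≤ T :=
    ValueDistribution.characteristic_monotoneOn hg (Set.mem_Ioi.2 (by linarith))
      (Set.mem_Ioi.2 (by linarith)) (by linarith)
  refine ⟨∑ u ∈ S, |(D u : ℝ)|, Finset.sum_nonneg fun u _ ↦ abs_nonneg _, ?_, ?_⟩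
  -- `D⁺ + D⁻ = |D|` counts zeros and poles together; the zeros are the poles of `g⁻¹`, whose
  -- characteristic differs from that of `g` by at most `C`.
  · have h1 := sum_mul_log_two_le_logCounting (E := D⁺ + D⁻)
      (add_nonneg (posPart_nonneg D) (negPart_nonneg D)) hR2 S (fun u hu ↦ ((hS u).1 hu).2)
    have h2 : ∀ u, (((D⁺ + D⁻) u : ℤ) : ℝ) = |(D u : ℝ)| := fun u ↦ by
      rw [Function.locallyFinsuppWithin.coe_add, Pi.add_apply,
        Function.locallyFinsuppWithin.posPart_apply, Function.locallyFinsuppWithin.negPart_apply,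
        posPart_add_negPart, Int.cast_abs]
    simp only [h2] at h1
    refine h1.trans ?_
    rw [map_add, Pi.add_apply, ← ValueDistribution.logCounting_zero,
      ← ValueDistribution.logCounting_top, ← ValueDistribution.logCounting_inv]
    have e : 2 * (2 * R) = 4 * R := by ring
    rw [e]
    have h3 := logCounting_le_characteristic g (4 * R)
    have h4 := logCounting_le_characteristic g⁻¹ (4 * R)
    linarith [(hinv (4 * R)).1]
  · refine proximity_le_of_sum_simple_poles (L := logDeriv G)
      (fun z ↦ (hg z).deriv.div (hg z)) hR S D ?_ (codiscreteWithin_mono ?_ hld)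
    · intro z hz
      have hzR : ‖z‖ = R := by simpa using hz
      refine (norm_logDeriv_le_circleAverage_abs_log hG hG0 (w := z)
        (by rw [mem_ball_zero_iff, hzR]; linarith)).trans ?_
      have h1 : 2 * (2 * R) / (2 * R - ‖z‖) ^ 2 ≤ 4 := by
        rw [hzR, show 2 * R - R = R by ring, div_le_iff₀ (by positivity)]
        nlinarith
      have h2 := circleAverage_abs_log_le hg hR2 S D (fun u hu ↦ ((hS u).1 hu).2) hlog
      have h3 := proximity_le_characteristic g hR2
      have h4 := proximity_le_characteristic g⁻¹ hR2
      have h5 := (hinv (2 * R)).1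
      have h6 : 0 ≤ Real.circleAverage (fun z ↦ |Real.log ‖G z‖|) 0 (2 * R) :=
        Real.circleAverage_nonneg_of_nonneg fun z _ ↦ abs_nonneg _
      refine mul_le_mul h1 (h2.trans ?_) h6 (by norm_num)
      rw [show 2 * (2 * R) = 4 * R by ring]
      linarith
    · intro z hz
      rw [mem_sphere_zero_iff_norm] at hz
      rw [mem_closedBall_zero_iff, hz]
      linarith

lemma le_exp_posLog (t : ℝ) : t ≤ Real.exp (Real.posLog t) := by
  by_cases ht : 0 < t
  · calc t = Real.exp (Real.log t) := (Real.exp_log ht).symm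
      _ ≤ _ := Real.exp_le_exp.2 (le_max_right _ _)
  · exact (not_lt.1 ht).trans (Real.exp_pos _).le

lemma posLog_le_of_le_mul_exp {x K s : ℝ} (hx : 0 ≤ x) (hK : 1 ≤ K) (hs : 0 ≤ s)
    (h : x ≤ K * Real.exp s) : Real.posLog x ≤ Real.log K + s := by
  have h1 : 1 ≤ K * Real.exp s := one_le_mul_of_one_le_of_one_le hK (Real.one_le_exp hs)
  calc _ ≤ Real.posLog (K * Real.exp s) := Real.posLog_le_posLog hx h
    _ = Real.log (K * Real.exp s) := Real.posLog_eq_log (h1.trans (le_abs_self _))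
    _ = _ := by rw [Real.log_mul (by linarith) (Real.exp_pos _).ne', Real.log_exp]

/-- **Lemma on the logarithmic derivative**, without exceptional set: the proximity function of
`g' / g` at `R` is controlled by the logarithm of the characteristic of `g` at `4 * R`. -/
theorem exists_proximity_logDeriv_le {g : ℂ → ℂ} (hg : Meromorphic g) :
    ∃ C, 0 ≤ C ∧ ∀ R, 1 ≤ R → ValueDistribution.proximity (logDeriv g) ⊤ R
      ≤ 3 * Real.posLog (ValueDistribution.characteristic g ⊤ (4 * R)) + Real.log R + C := by
  by_cases h : ∃ u, meromorphicOrderAt g u = ⊤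
  · obtain ⟨u, hu⟩ := h
    refine ⟨0, le_rfl, fun R hR ↦ ?_⟩
    have h0 : logDeriv g =ᶠ[codiscrete ℂ] fun _ ↦ 0 := by
      filter_upwards [hg.eventuallyEq_zero_codiscrete hu] with z hz
      simp [logDeriv_apply, hz]
    rw [ValueDistribution.proximity_congr_codiscrete h0 (by linarith),
      ValueDistribution.proximity_const, norm_zero, Real.posLog_zero]
    have := Real.posLog_nonneg (x := ValueDistribution.characteristic g ⊤ (4 * R))
    have := Real.log_nonneg hR
    linarith
  · push Not at h
    obtain ⟨C, hC0, hC⟩ := exists_characteristic_inv_le hg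
    -- With `t = log⁺ T`: `2T + C ≤ (2 + C) eᵗ`, `n ≤ 2(2 + C) eᵗ` and `2 log (4R) ≤ 8R`; hence `68
    -- = 4(1 + 16)`.
    set K := 68 * (2 + C) with hK
    have hK1 : 1 ≤ K := by rw [hK]; linarith
    refine ⟨Real.log 2 + 3 * Real.log K, ?_, fun R hR ↦ ?_⟩
    · have := Real.log_nonneg hK1
      have := Real.log_nonneg (one_le_two (α := ℝ))
      positivity
    obtain ⟨n, hn0, hn, hp⟩ := proximity_logDeriv_le_aux hg h hR hC
    set T := ValueDistribution.characteristic g ⊤ (4 * R) with hT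
    have hT0 : 0 ≤ T := (ValueDistribution.characteristic_nonneg (by linarith))
    set t := Real.posLog T with ht
    have ht0 : 0 ≤ t := Real.posLog_nonneg
    have hlR : 0 ≤ Real.log R := Real.log_nonneg hR
    have hTt : T ≤ Real.exp t := le_exp_posLog T
    have het : 1 ≤ Real.exp t := Real.one_le_exp ht0
    have hCt : 2 * T + C ≤ (2 + C) * Real.exp t := by nlinarith
    have hlog2 := Real.log_two_gt_d9
    have hn' : n ≤ 2 * (2 + C) * Real.exp t := by nlinarith
    have hexp : Real.exp (t + Real.log R) = Real.exp t * R := by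
      rw [Real.exp_add, Real.exp_log (by linarith)]
    have hlog4 : Real.log (4 * R) ≤ 4 * R := by
      linarith [Real.log_le_sub_one_of_pos (show 0 < 4 * R by linarith)]
    have hlog40 : 0 ≤ Real.log (4 * R) := Real.log_nonneg (by linarith)
    have h1 : Real.posLog (4 * (2 * T + C + n * (2 * Real.log (4 * R))))
        ≤ Real.log K + (t + Real.log R) := by
      refine posLog_le_of_le_mul_exp (by positivity) hK1 (by positivity) ?_
      rw [hexp]
      have a1 : n * (2 * Real.log (4 * R)) ≤ 2 * (2 + C) * Real.exp t * (2 * (4 * R)) := by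
        gcongr
      have a2 : (2 + C) * Real.exp t ≤ (2 + C) * Real.exp t * R :=
        le_mul_of_one_le_right (by positivity) hR
      rw [hK]
      nlinarith
    have h2 : Real.log (1 + 3 * n) ≤ Real.log K + t := by
      rw [← Real.posLog_eq_log (x := 1 + 3 * n) (by rw [abs_of_pos] <;> linarith)]
      refine posLog_le_of_le_mul_exp (by positivity) hK1 ht0 ?_
      rw [hK]
      nlinarith
    linarith

/-! ### Iterates of the derivation `w² d/dw` -/

lemma proximity_sq {R : ℝ} (hR : 1 ≤ R) :
    ValueDistribution.proximity ((fun w : ℂ ↦ w) ^ 2) ⊤ R = 2 * Real.log R := by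
  rw [ValueDistribution.proximity_pow_top, ValueDistribution.proximity_top]
  have habs : |R| = R := abs_of_pos (by linarith)
  rw [Pi.smul_apply, Real.circleAverage_const_on_circle (a := Real.log R)]
  · simp
  · intro x hx
    have hx : ‖x‖ = R := by simpa [habs] using hx
    rw [hx, Real.posLog_eq_log (by rwa [habs])]

lemma proximity_mul_le {f₁ f₂ : ℂ → ℂ} (h₁ : Meromorphic f₁) (h₂ : Meromorphic f₂) (R : ℝ) :
    ValueDistribution.proximity (f₁ * f₂) ⊤ R
      ≤ ValueDistribution.proximity f₁ ⊤ R + ValueDistribution.proximity f₂ ⊤ R :=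
  ValueDistribution.proximity_mul_top_le h₁ h₂ R

lemma _root_.Meromorphic.logDeriv_of_complex {g : ℂ → ℂ} (hg : Meromorphic g) : Meromorphic (logDeriv g) :=
  fun z ↦ (hg z).deriv.div (hg z)

lemma meromorphic_id : Meromorphic (fun w : ℂ ↦ w) := fun z ↦ MeromorphicAt.id z

/-- Proximity of `(w² g') h` in terms of the logarithmic derivative of `g` and of `g h`. -/
lemma proximity_sqDeriv_mul_le {g h : ℂ → ℂ} (hg : Meromorphic g) (hh : Meromorphic h) {R : ℝ}
    (hR : 1 ≤ R) :
    ValueDistribution.proximity (sqDeriv g * h) ⊤ R ≤ 2 * Real.log R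
      + ValueDistribution.proximity (logDeriv g) ⊤ R
      + ValueDistribution.proximity (g * h) ⊤ R := by
  -- The free factor `h` serves twice: `h = 1` bounds `Dg` itself, and `h = g₀⁻¹` drives the
  -- induction for `Dʲg₀/g₀`.
  have heq : sqDeriv g * h =ᶠ[codiscrete ℂ] (fun w : ℂ ↦ w) ^ 2 * (logDeriv g * (g * h)) := by
    filter_upwards [deriv_eq_logDeriv_mul_codiscrete hg] with z hz
    simp only [Pi.mul_apply, sqDeriv, hz, Pi.pow_apply]
    ring
  rw [ValueDistribution.proximity_congr_codiscrete heq (by linarith)]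
  have h1 := proximity_mul_le (meromorphic_id.pow (n := 2)) (hg.logDeriv_of_complex.mul (hg.mul hh)) R
  have h2 := proximity_mul_le hg.logDeriv_of_complex (hg.mul hh) R
  rw [proximity_sq hR] at h1
  linarith

/-- Differentiation turns a pole of order `m ≥ 1` into one of order `m + 1 ≤ 2m` and creates no new
poles; the factor `w²` creates none either. -/
lemma negPart_meromorphicOrderAt_sqDeriv_le {g : ℂ → ℂ} (hg : Meromorphic g) (z : ℂ) :
    ((meromorphicOrderAt (sqDeriv g) z).untop₀)⁻ ≤ 2 * ((meromorphicOrderAt g z).untop₀)⁻ := by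
  have hsq : sqDeriv g = (fun w : ℂ ↦ w) ^ 2 * deriv g := rfl
  have hsqo : 0 ≤ meromorphicOrderAt ((fun w : ℂ ↦ w) ^ 2) z :=
    (analyticAt_id.pow 2).meromorphicOrderAt_nonneg
  have key : meromorphicOrderAt (deriv g) z ≤ meromorphicOrderAt (sqDeriv g) z := by
    rw [hsq, meromorphicOrderAt_mul (meromorphic_id.pow (n := 2) z) (hg z).deriv]
    exact le_add_of_nonneg_left hsqo
  by_cases htop : meromorphicOrderAt (sqDeriv g) z = ⊤
  · rw [htop]
    simp only [WithTop.untop₀_top, negPart_zero]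
    have := negPart_nonneg (meromorphicOrderAt g z).untop₀
    positivity
  lift meromorphicOrderAt (sqDeriv g) z to ℤ using htop with m hm
  by_cases hgtop : meromorphicOrderAt g z = ⊤
  · exfalso
    have h0 : deriv g =ᶠ[𝓝[≠] z] fun _ ↦ 0 := by
      have := (meromorphicOrderAt_eq_top_iff.1 hgtop)
      have h1 : g =ᶠ[𝓝[≠] z] fun _ ↦ 0 := this
      filter_upwards [h1.nhdsNE_deriv] with w hw
      simpa using hw
    have h1 : meromorphicOrderAt (deriv g) z = ⊤ := meromorphicOrderAt_eq_top_iff.2 h0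
    rw [h1] at key
    exact absurd (top_le_iff.1 key) (WithTop.coe_ne_top)
  lift meromorphicOrderAt g z to ℤ using hgtop with n hn
  have hle : min 0 (n - 1) ≤ m ∧ (0 ≤ n → 0 ≤ m) := by
    by_cases hn0 : n = 0
    · subst hn0
      have h1 : 0 ≤ meromorphicOrderAt (deriv g) z := by
        obtain ⟨φ, hφ, -, hφg⟩ := (meromorphicOrderAt_eq_int_iff (hg z)).1 hn.symm
        have h2 : g =ᶠ[𝓝[≠] z] φ := by
          filter_upwards [hφg] with w hw
          simpa using hw
        rw [meromorphicOrderAt_congr h2.nhdsNE_deriv]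
        exact hφ.deriv.meromorphicOrderAt_nonneg
      have h3 : (0 : ℤ) ≤ m := by exact_mod_cast h1.trans key
      exact ⟨by omega, fun _ ↦ h3⟩
    · rw [meromorphicOrderAt_deriv_eq_sub_one (by exact_mod_cast hn0) hn.symm] at key
      have h3 : n - 1 ≤ m := by exact_mod_cast key
      exact ⟨by omega, fun h ↦ by omega⟩
  simp only [WithTop.untop₀_coe, negPart_def]
  have := hle.1
  have := hle.2
  rcases lt_or_ge n 0 with h | h
  · have h2 : -n ⊔ 0 = -n := by simp [h.le]
    rw [h2]
    refine sup_le ?_ ?_ <;> omega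
  · have h2 : -n ⊔ 0 = 0 := by simp [h]
    rw [h2]
    refine sup_le ?_ ?_ <;> omega

lemma logCounting_sqDeriv_le {g : ℂ → ℂ} (hg : Meromorphic g) {R : ℝ} (hR : 1 ≤ R) :
    ValueDistribution.logCounting (sqDeriv g) ⊤ R
      ≤ 2 * ValueDistribution.logCounting g ⊤ R := by
  rw [ValueDistribution.logCounting_top, ValueDistribution.logCounting_top]
  have h1 : (MeromorphicOn.divisor (sqDeriv g) Set.univ)⁻
      ≤ (MeromorphicOn.divisor g Set.univ)⁻ + (MeromorphicOn.divisor g Set.univ)⁻ := by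
    intro z
    rw [Function.locallyFinsuppWithin.coe_add, Pi.add_apply,
      Function.locallyFinsuppWithin.negPart_apply, Function.locallyFinsuppWithin.negPart_apply,
      MeromorphicOn.divisor_apply hg.sqDeriv.meromorphicOn (Set.mem_univ z),
      MeromorphicOn.divisor_apply hg.meromorphicOn (Set.mem_univ z)]
    have := negPart_meromorphicOrderAt_sqDeriv_le hg z
    linarith
  have h2 := Function.locallyFinsuppWithin.logCounting_le h1 hR
  rw [map_add, Pi.add_apply] at h2
  linarith

lemma characteristic_mono {g : ℂ → ℂ} (hg : Meromorphic g) {R R' : ℝ} (hR : 0 < R)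
    (h : R ≤ R') :
    ValueDistribution.characteristic g ⊤ R ≤ ValueDistribution.characteristic g ⊤ R' :=
  ValueDistribution.characteristic_monotoneOn hg (Set.mem_Ioi.2 hR)
    (Set.mem_Ioi.2 (hR.trans_le h)) h

lemma posLog_characteristic_mono {g : ℂ → ℂ} (hg : Meromorphic g) {R R' : ℝ} (hR : 1 ≤ R)
    (h : R ≤ R') :
    Real.posLog (ValueDistribution.characteristic g ⊤ R)
      ≤ Real.posLog (ValueDistribution.characteristic g ⊤ R') :=
  Real.posLog_le_posLog (ValueDistribution.characteristic_nonneg hR)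
    (characteristic_mono hg (by linarith) h)

/-- A crude linear bound suffices, since afterwards only `log⁺` of the characteristic matters and
the factor 6 becomes additive. -/
lemma exists_characteristic_sqDeriv_le {g : ℂ → ℂ} (hg : Meromorphic g) :
    ∃ C, 0 ≤ C ∧ ∀ R, 1 ≤ R → ValueDistribution.characteristic (sqDeriv g) ⊤ R
      ≤ 6 * ValueDistribution.characteristic g ⊤ (4 * R) + 3 * Real.log R + C := by
  obtain ⟨C, hC0, hC⟩ := exists_proximity_logDeriv_le hg
  refine ⟨C, hC0, fun R hR ↦ ?_⟩
  have h1 := proximity_sqDeriv_mul_le hg (Meromorphic.const 1) hR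
  have e1 : sqDeriv g * (fun _ ↦ (1 : ℂ)) = sqDeriv g := by ext; simp
  have e2 : g * (fun _ ↦ (1 : ℂ)) = g := by ext; simp
  rw [e1, e2] at h1
  have h2 := logCounting_sqDeriv_le hg hR
  have h3 := hC R hR
  have hT : 0 ≤ ValueDistribution.characteristic g ⊤ (4 * R) :=
    ValueDistribution.characteristic_nonneg (by linarith)
  have h4 : Real.posLog (ValueDistribution.characteristic g ⊤ (4 * R))
      ≤ ValueDistribution.characteristic g ⊤ (4 * R) :=
    max_le hT (Real.log_le_self hT)
  have h5 := characteristic_mono hg (by linarith : 0 < R) (by linarith : R ≤ 4 * R)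
  have h6 := proximity_le_characteristic g hR
  have h7 := logCounting_le_characteristic g R
  rw [ValueDistribution.characteristic, Pi.add_apply]
  linarith

lemma log_four_mul_le {R : ℝ} (hR : 1 ≤ R) : Real.log (4 * R) ≤ 3 + Real.log R := by
  rw [Real.log_mul (by norm_num) (by linarith)]
  linarith [Real.log_le_sub_one_of_pos (show (0 : ℝ) < 4 by norm_num)]

lemma exists_posLog_characteristic_sqDeriv_iterate_le {g : ℂ → ℂ} (hg : Meromorphic g) (j : ℕ) :
    ∃ C, 0 ≤ C ∧ ∀ R, 1 ≤ R →
      Real.posLog (ValueDistribution.characteristic (sqDeriv^[j] g) ⊤ R)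
        ≤ C * (Real.posLog (ValueDistribution.characteristic g ⊤ (4 ^ j * R)) + Real.log R + 1) := by
  induction j with
  | zero =>
    refine ⟨1, zero_le_one, fun R hR ↦ ?_⟩
    have := Real.log_nonneg hR
    simp only [Function.iterate_zero, id_eq, pow_zero, one_mul]
    linarith
  | succ j ih =>
    obtain ⟨C, hC0, hC⟩ := ih
    obtain ⟨C', hC'0, hC'⟩ := exists_characteristic_sqDeriv_le (hg.sqDeriv_iterate j)
    have hK : 1 ≤ 9 + C' := by linarith
    have hlogK := Real.log_nonneg hK
    refine ⟨Real.log (9 + C') + 4 * C + 1, by positivity, fun R hR ↦ ?_⟩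
    rw [Function.iterate_succ_apply']
    have h1 := hC' R hR
    have h2 := hC (4 * R) (by linarith)
    have h3 := log_four_mul_le hR
    have hlR := Real.log_nonneg hR
    rw [show (4 : ℝ) ^ j * (4 * R) = 4 ^ (j + 1) * R by ring] at h2
    set a := Real.posLog (ValueDistribution.characteristic g ⊤ (4 ^ (j + 1) * R)) with ha
    have ha0 : 0 ≤ a := Real.posLog_nonneg
    set T := ValueDistribution.characteristic (sqDeriv^[j] g) ⊤ (4 * R) with hT
    have h4 : ValueDistribution.characteristic (sqDeriv (sqDeriv^[j] g)) ⊤ R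
        ≤ (9 + C') * Real.exp (Real.posLog T + Real.log R) := by
      rw [Real.exp_add, Real.exp_log (by linarith)]
      have e1 := le_exp_posLog T
      have e2 : 1 ≤ Real.exp (Real.posLog T) := Real.one_le_exp Real.posLog_nonneg
      have e3 : Real.exp (Real.posLog T) ≤ Real.exp (Real.posLog T) * R :=
        le_mul_of_one_le_right (by linarith) hR
      have e4 : Real.log R ≤ R := Real.log_le_self (by linarith)
      have e5 : R ≤ Real.exp (Real.posLog T) * R := le_mul_of_one_le_left (by linarith) e2
      nlinarith
    have h5 := posLog_le_of_le_mul_exp (ValueDistribution.characteristic_nonneg hR) hK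
      (add_nonneg Real.posLog_nonneg hlR) h4
    have h6 : C * (a + Real.log (4 * R) + 1) ≤ C * (4 * (a + Real.log R + 1)) := by
      gcongr
      linarith
    have h7 : Real.log (9 + C') ≤ Real.log (9 + C') * (a + Real.log R + 1) :=
      le_mul_of_one_le_right hlogK (by linarith)
    linarith

/-- Induction on `Dʲ⁺¹g/g = (D(Dʲg)/Dʲg) · (Dʲg/g)`: the logarithmic derivative lemma is applied to
`Dʲg`, whose `log⁺ T` is controlled by that of `g`. Each step enlarges the radius by a factor 4. -/
lemma exists_proximity_sqDeriv_iterate_div_le {g : ℂ → ℂ} (hg : Meromorphic g) (j : ℕ) :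
    ∃ C, 0 ≤ C ∧ ∀ R, 1 ≤ R →
      ValueDistribution.proximity (sqDeriv^[j] g * g⁻¹) ⊤ R
        ≤ C * (Real.posLog (ValueDistribution.characteristic g ⊤ (4 ^ j * R)) + Real.log R + 1) := by
  induction j with
  | zero =>
    refine ⟨0, le_rfl, fun R hR ↦ ?_⟩
    rw [ValueDistribution.proximity_top, zero_mul, Function.iterate_zero, id]
    apply Real.circleAverage_mono_on_of_le_circle
      (hg.mul hg.inv).meromorphicOn.circleIntegrable_posLog_norm
    intro z _
    rw [Pi.mul_apply, Pi.inv_apply]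
    by_cases hz : g z = 0
    · simp [hz]
    · simp [mul_inv_cancel₀ hz]
  | succ j ih =>
    obtain ⟨C, hC0, hC⟩ := ih
    obtain ⟨C₁, hC₁0, hC₁⟩ := exists_proximity_logDeriv_le (hg.sqDeriv_iterate j)
    obtain ⟨C₂, hC₂0, hC₂⟩ := exists_posLog_characteristic_sqDeriv_iterate_le hg j
    refine ⟨C + C₁ + 12 * C₂ + 3, by positivity, fun R hR ↦ ?_⟩
    rw [Function.iterate_succ_apply']
    have h1 := proximity_sqDeriv_mul_le (hg.sqDeriv_iterate j) hg.inv hR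
    have h2 := hC R hR
    have h3 := hC₁ R hR
    have h4 := hC₂ (4 * R) (by linarith)
    have h5 := log_four_mul_le hR
    have hlR := Real.log_nonneg hR
    rw [show (4 : ℝ) ^ j * (4 * R) = 4 ^ (j + 1) * R by ring] at h4
    have h4j : (1 : ℝ) ≤ 4 ^ j := one_le_pow₀ (by norm_num)
    have h6 : Real.posLog (ValueDistribution.characteristic g ⊤ (4 ^ j * R))
        ≤ Real.posLog (ValueDistribution.characteristic g ⊤ (4 ^ (j + 1) * R)) := by
      apply posLog_characteristic_mono hg (one_le_mul_of_one_le_of_one_le h4j hR)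
      rw [pow_succ, mul_assoc]
      gcongr
      linarith
    set a := Real.posLog (ValueDistribution.characteristic g ⊤ (4 ^ (j + 1) * R)) with ha
    have ha0 : 0 ≤ a := Real.posLog_nonneg
    have h7 : C * (Real.posLog (ValueDistribution.characteristic g ⊤ (4 ^ j * R)) + Real.log R + 1)
        ≤ C * (a + Real.log R + 1) := by gcongr
    have h8 : C₂ * (a + Real.log (4 * R) + 1) ≤ C₂ * (4 * (a + Real.log R + 1)) := by
      gcongr
      linarith
    have h9 : C₁ ≤ C₁ * (a + Real.log R + 1) := le_mul_of_one_le_right hC₁0 (by linarith)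
    linarith

/-! ### Minimal growth of nonconstant functions -/

/-- A meromorphic function on the plane that is not constant has characteristic at least
`log R - O(1)`. -/
lemma exists_log_sub_le_characteristic {g : ℂ → ℂ} (hg : Meromorphic g)
    (hne : ∀ c : ℂ, ¬ g =ᶠ[codiscrete ℂ] fun _ ↦ c) :
    ∃ C, ∀ R, 1 ≤ R → Real.log R - C ≤ ValueDistribution.characteristic g ⊤ R := by
  have hpole : ∀ h : ℂ → ℂ, Meromorphic h → meromorphicOrderAt h 0 < 0 → ∀ R, 1 ≤ R →
      Real.log R ≤ ValueDistribution.characteristic h ⊤ R := by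
    intro h hh hord R hR
    refine le_trans ?_ (logCounting_le_characteristic h R)
    rw [ValueDistribution.logCounting_top]
    have h1 : Function.locallyFinsuppWithin.single (0 : ℂ) (1 : ℤ)
        ≤ (MeromorphicOn.divisor h Set.univ)⁻ := by
      intro z
      rw [Function.locallyFinsuppWithin.single_apply]
      split_ifs with hz
      · subst hz
        rw [Function.locallyFinsuppWithin.negPart_apply,
          MeromorphicOn.divisor_apply hh.meromorphicOn (Set.mem_univ _)]
        have htop : meromorphicOrderAt h 0 ≠ ⊤ := hord.ne_top
        lift meromorphicOrderAt h 0 to ℤ using htop with n hn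
        have hn0 : n < 0 := by exact_mod_cast hord
        rw [WithTop.untop₀_coe, negPart_def]
        exact le_sup_of_le_left (by omega)
      · rw [Function.locallyFinsuppWithin.negPart_apply]
        exact negPart_nonneg _
    have h2 := Function.locallyFinsuppWithin.logCounting_le h1 hR
    rw [Function.locallyFinsuppWithin.logCounting_single_eq_log_sub_const (by simp; linarith)] at h2
    simpa using h2
  by_cases hord : meromorphicOrderAt g 0 < 0
  · exact ⟨0, fun R hR ↦ by simpa using hpole g hg hord R hR⟩
  push Not at hord
  -- Without a pole at the origin, pass to `1/(g - a)` with `a` the limit of `g` at 0. It has a pole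
  -- there, and its characteristic differs from that of `g` by a bounded amount.
  obtain ⟨a, ha⟩ := tendsto_nhds_of_meromorphicOrderAt_nonneg (hg 0) hord
  set h : ℂ → ℂ := fun z ↦ g z - a with hh
  have hm : Meromorphic h := hg.sub (Meromorphic.const a)
  have hpos : 0 < meromorphicOrderAt h 0 := by
    rw [← tendsto_zero_iff_meromorphicOrderAt_pos (hm 0)]
    simpa using ha.sub_const a
  have htop : meromorphicOrderAt h 0 ≠ ⊤ := by
    intro h0
    refine hne a ?_
    filter_upwards [hm.eventuallyEq_zero_codiscrete h0] with z hz
    simpa [hh, sub_eq_zero] using hz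
  have hinv : meromorphicOrderAt h⁻¹ 0 < 0 := by
    rw [meromorphicOrderAt_inv]
    lift meromorphicOrderAt h 0 to ℤ using htop with n hn
    have : 0 < n := by exact_mod_cast hpos
    have : -n < 0 := by omega
    exact_mod_cast this
  obtain ⟨C, -, hC⟩ := exists_characteristic_inv_le hm
  refine ⟨C + (Real.posLog ‖a‖ + Real.log 2), fun R hR ↦ ?_⟩
  have h1 := hpole _ hm.inv hinv R hR
  have h2 := (abs_le.1 (hC R)).1
  have h3 := (abs_le.1 (ValueDistribution.abs_characteristic_sub_characteristic_shift_le (a₀ := a)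
    (r := R) hg)).1
  linarith

/-! ### The differential equation in the plane -/

lemma proximity_neg (g : ℂ → ℂ) :
    ValueDistribution.proximity (-g) ⊤ = ValueDistribution.proximity g ⊤ := by
  simp [ValueDistribution.proximity_top]

lemma not_eventuallyEq_toPlane_const {P : ℂ → ℂ} {z₀ c : ℂ} (h : ¬ SameFun P (fun _ ↦ c) z₀) :
    ¬ toPlane P z₀ =ᶠ[codiscrete ℂ] fun _ ↦ c :=
  fun h' ↦ h (sameFun_of_toPlane_eventuallyEq h')

lemma meromorphicOrderAt_toPlane_ne_top {f : ℂ → ℂ} {z₀ : ℂ} (hf : IsMeromorphic f z₀)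
    (hf_ne : ¬ SameFun f (fun _ ↦ 0) z₀) (u : ℂ) : meromorphicOrderAt (toPlane f z₀) u ≠ ⊤ :=
  fun h ↦ not_eventuallyEq_toPlane_const hf_ne (hf.toPlane.eventuallyEq_zero_codiscrete h)

/-- The differential equation in the coordinate `w = (z₀ - z)⁻¹`. -/
lemma IsSolution.toPlane {k : ℕ} {A : ℕ → ℂ → ℂ} {f : ℂ → ℂ} {z₀ : ℂ}
    (hA : ∀ j < k, IsMeromorphic (A j) z₀) (hf : IsMeromorphic f z₀)
    (h : IsSolution k A f z₀) :
    sqDeriv^[k] (toPlane f z₀) + ∑ j ∈ Finset.range k,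
      toPlane (A j) z₀ * sqDeriv^[j] (toPlane f z₀) =ᶠ[codiscrete ℂ] 0 := by
  have hm : Meromorphic (sqDeriv^[k] (PuncturedSphere.toPlane f z₀) + ∑ j ∈ Finset.range k,
      PuncturedSphere.toPlane (A j) z₀ * sqDeriv^[j] (PuncturedSphere.toPlane f z₀)) := by
    refine (hf.toPlane.sqDeriv_iterate k).add (Meromorphic.sum fun j hj ↦ ?_)
    exact (hA j (Finset.mem_range.1 hj)).toPlane.mul (hf.toPlane.sqDeriv_iterate j)
  -- Any nonzero point would do: the identity theorem carries the equation across `w = 0`, where the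
  -- hypothesis gives no direct information.
  refine hm.eventuallyEq_zero_codiscrete (x := 1) (meromorphicOrderAt_eq_top_iff.2 ?_)
  filter_upwards [toPlane_eventuallyEq_of_sameFun h one_ne_zero,
    nhdsWithin_le_nhds (isOpen_ne.mem_nhds one_ne_zero)] with w hw hw0
  have hw0 : w ≠ 0 := hw0
  rw [Pi.add_apply, Finset.sum_apply, ← toPlane_iteratedDeriv f z₀ k hw0]
  refine Eq.trans ?_ hw
  simp only [PuncturedSphere.toPlane]
  congr 1
  refine Finset.sum_congr rfl fun j _ ↦ ?_
  rw [Pi.mul_apply, ← toPlane_iteratedDeriv f z₀ j hw0]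
  rfl

/-- The proximity function of the lowest coefficient is bounded by those of the other
coefficients and the logarithm of the characteristic of any nontrivial solution. -/
lemma exists_proximity_coeff_zero_le {k : ℕ} (hk : 1 ≤ k) {B : ℕ → ℂ → ℂ} {g : ℂ → ℂ}
    (hB : ∀ j < k, Meromorphic (B j)) (hg : Meromorphic g)
    (hg' : ∀ u, meromorphicOrderAt g u ≠ ⊤)
    (h : sqDeriv^[k] g + ∑ j ∈ Finset.range k, B j * sqDeriv^[j] g =ᶠ[codiscrete ℂ] 0) :
    ∃ K, 0 ≤ K ∧ ∀ R, 1 ≤ R → ValueDistribution.proximity (B 0) ⊤ R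
      ≤ ∑ j ∈ Finset.Ico 1 k, ValueDistribution.proximity (B j) ⊤ R
        + K * (Real.posLog (ValueDistribution.characteristic g ⊤ (4 ^ k * R))
          + Real.log R + 1) := by
  choose C hC0 hC using exists_proximity_sqDeriv_iterate_div_le hg
  -- The leading coefficient 1 is included as `c k`; it has proximity 0, so the top term fits the
  -- same estimate.
  set c : ℕ → ℂ → ℂ := fun j ↦ if j < k then B j else fun _ ↦ 1 with hc
  have hcm : ∀ j, Meromorphic (c j) := fun j ↦ by
    simp only [hc]
    split_ifs with hj
    · exact hB j hj
    · exact Meromorphic.const 1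
  set q : ℕ → ℂ → ℂ := fun j ↦ sqDeriv^[j] g * g⁻¹ with hq
  have hqm : ∀ j, Meromorphic (q j) := fun j ↦ (hg.sqDeriv_iterate j).mul hg.inv
  have hck : c k = fun _ ↦ 1 := by simp [hc]
  have heq : -B 0 =ᶠ[codiscrete ℂ] ∑ j ∈ Finset.Ico 1 (k + 1), c j * q j := by
    filter_upwards [h, hg.meromorphicOn.eventually_codiscreteWithin_apply_ne_zero (U := Set.univ)
      (fun u _ ↦ hg' u)] with z hz hgz
    rw [Finset.range_eq_Ico, Finset.sum_eq_sum_Ico_succ_bot (by omega)] at hz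
    simp only [zero_add, Pi.add_apply, Pi.mul_apply, Finset.sum_apply, Function.iterate_zero,
      id_eq, Pi.zero_apply] at hz
    rw [Finset.sum_Ico_succ_top hk, Pi.add_apply, Finset.sum_apply, hck]
    have hsum : ∑ j ∈ Finset.Ico 1 k, (c j * q j) z
        = (∑ j ∈ Finset.Ico 1 k, B j z * sqDeriv^[j] g z) * (g z)⁻¹ := by
      rw [Finset.sum_mul]
      refine Finset.sum_congr rfl fun j hj ↦ ?_
      have : c j = B j := by simp [hc, (Finset.mem_Ico.1 hj).2]
      rw [Pi.mul_apply, this, hq]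
      simp only [Pi.mul_apply, Pi.inv_apply]
      ring
    rw [hsum]
    simp only [hq, Pi.neg_apply, Pi.mul_apply, Pi.inv_apply]
    field_simp
    linear_combination -hz
  refine ⟨∑ j ∈ Finset.Ico 1 (k + 1), C j + Real.log k,
    add_nonneg (Finset.sum_nonneg fun j _ ↦ hC0 j) (Real.log_natCast_nonneg k), fun R hR ↦ ?_⟩
  have hlR := Real.log_nonneg hR
  set a := Real.posLog (ValueDistribution.characteristic g ⊤ (4 ^ k * R)) + Real.log R + 1 with ha
  have ha1 : 1 ≤ a := by
    have : 0 ≤ Real.posLog (ValueDistribution.characteristic g ⊤ (4 ^ k * R)) := Real.posLog_nonneg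
    linarith
  rw [← proximity_neg, ValueDistribution.proximity_congr_codiscrete heq (by linarith)]
  have h1 := ValueDistribution.proximity_sum_top_le (Finset.Ico 1 (k + 1)) (fun j ↦ c j * q j)
    (fun j _ ↦ (hcm j).mul (hqm j)) R
  rw [Pi.add_apply, Finset.sum_apply] at h1
  have h2 : ∑ j ∈ Finset.Ico 1 (k + 1), ValueDistribution.proximity (c j * q j) ⊤ R
      ≤ ∑ j ∈ Finset.Ico 1 (k + 1), (ValueDistribution.proximity (c j) ⊤ R + C j * a) := by
    refine Finset.sum_le_sum fun j hj ↦ (proximity_mul_le (hcm j) (hqm j) R).trans ?_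
    gcongr
    refine (hC j R hR).trans ?_
    have hjk : j ≤ k := Nat.lt_succ_iff.1 (Finset.mem_Ico.1 hj).2
    have h4j : (1 : ℝ) ≤ 4 ^ j := one_le_pow₀ (by norm_num)
    have hle : (4 : ℝ) ^ j * R ≤ 4 ^ k * R := by
      gcongr
      norm_num
    have hT := posLog_characteristic_mono hg (one_le_mul_of_one_le_of_one_le h4j hR) hle
    exact mul_le_mul_of_nonneg_left (by linarith) (hC0 j)
  have h3 : ∑ j ∈ Finset.Ico 1 (k + 1), ValueDistribution.proximity (c j) ⊤ R
      = ∑ j ∈ Finset.Ico 1 k, ValueDistribution.proximity (B j) ⊤ R := by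
    rw [Finset.sum_Ico_succ_top hk, hck, ValueDistribution.proximity_const, norm_one,
      Real.posLog_one, add_zero]
    refine Finset.sum_congr rfl fun j hj ↦ ?_
    simp [hc, (Finset.mem_Ico.1 hj).2]
  rw [Finset.sum_add_distrib, ← Finset.sum_mul, h3] at h2
  have h4 : Real.log ((Finset.Ico 1 (k + 1)).card : ℝ) ≤ Real.log k * a := by
    rw [Nat.card_Ico, Nat.add_sub_cancel]
    exact le_mul_of_one_le_right (Real.log_natCast_nonneg k) ha1
  linarith

/-! ### Comparison of growth on the logarithmic scale -/

lemma eventually_mul_rpow_le {p q : ℝ} (hpq : p < q) (hq : 0 < q) (C κ : ℝ) :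
    ∀ᶠ x : ℝ in atTop, C * x ^ p ≤ (x - κ) ^ q := by
  have h1 := tendsto_rpow_atTop (sub_pos.2 hpq)
  filter_upwards [h1.eventually_ge_atTop (C * 2 ^ q), eventually_ge_atTop (2 * κ),
    eventually_gt_atTop 0] with x hx hκ h0
  have h2 : (x / 2) ^ q ≤ (x - κ) ^ q :=
    Real.rpow_le_rpow (by positivity) (by linarith) hq.le
  refine le_trans ?_ h2
  rw [Real.div_rpow h0.le (by norm_num), le_div_iff₀ (by positivity)]
  have h3 : x ^ q = x ^ (q - p) * x ^ p := by
    rw [← Real.rpow_add h0]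
    congr 1
    ring
  rw [h3]
  have : 0 ≤ x ^ p := Real.rpow_nonneg h0.le _
  nlinarith

lemma tendsto_log_one_div : Tendsto (fun r : ℝ ↦ Real.log (1 / r)) (𝓝[>] 0) atTop := by
  simp only [one_div, Real.log_inv]
  exact tendsto_neg_atBot_atTop.comp Real.tendsto_log_nhdsGT_zero

lemma mul_log_le_posLog {x b t : ℝ} (hx : 0 < x) (h : x ^ b ≤ t) :
    b * Real.log x ≤ Real.posLog t := by
  rw [← Real.log_rpow hx]
  exact (Real.log_le_log (Real.rpow_pos_of_pos hx _) h).trans (le_max_right _ _)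

lemma rpow_le_of_mul_log_lt_posLog {x b t : ℝ} (hx : 0 < x) (hb : 0 ≤ b * Real.log x)
    (h : b * Real.log x < Real.posLog t) (ht : 0 ≤ t) : x ^ b ≤ t := by
  have ht1 : 1 < t := by
    by_contra! h1
    rw [(Real.posLog_eq_zero_iff t).2 (by rwa [abs_of_nonneg ht])] at h
    linarith
  rw [Real.posLog_eq_log (ht1.le.trans (le_abs_self t))] at h
  rw [← Real.log_le_log_iff (Real.rpow_pos_of_pos hx b) (by linarith), Real.log_rpow hx]
  exact h.le

lemma lowerOrder22_nonneg (f : ℂ → ℂ) (z₀ : ℂ) : 0 ≤ lowerOrder22 f z₀ := by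
  refine le_liminf_of_le (by isBoundedDefault) ?_
  filter_upwards [tendsto_log_one_div.eventually_ge_atTop 1] with r hr
  exact_mod_cast div_nonneg Real.posLog_nonneg (Real.log_nonneg hr)

/-- `T ≥ log (1/r) - C` eventually exceeds `(log 1/r)ᵇ` for every `b < 1`. -/
lemma one_le_logLowerOrder {F : ℂ → ℂ} {z₀ : ℂ} (hF : IsMeromorphic F z₀)
    (hne : ¬ ∃ c : ℂ, SameFun F (fun _ ↦ c) z₀) : 1 ≤ logLowerOrder F z₀ := by
  obtain ⟨C, hC⟩ := exists_log_sub_le_characteristic hF.toPlane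
    (fun c ↦ not_eventuallyEq_toPlane_const (fun h ↦ hne ⟨c, h⟩))
  refine le_of_forall_lt_imp_le_of_dense fun c hc ↦ ?_
  obtain ⟨b, hcb, hb1⟩ := EReal.lt_iff_exists_real_btwn.1 hc
  refine hcb.le.trans (le_liminf_of_le (by isBoundedDefault) ?_)
  have hb : b < 1 := by exact_mod_cast hb1
  filter_upwards [tendsto_log_one_div.eventually (eventually_mul_rpow_le hb one_pos 1 C),
    tendsto_log_one_div.eventually_gt_atTop 1, Ioo_mem_nhdsGT one_pos] with r h1 h2 hr
  have h3 := hC r⁻¹ (one_le_inv_iff₀.2 ⟨hr.1, hr.2.le⟩)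
  rw [← characteristic_eq hF hr.1, ← one_div] at h3
  rw [one_mul, Real.rpow_one] at h1
  have h4 := mul_log_le_posLog (by linarith) (h1.trans h3)
  have hpos : 0 < Real.log (Real.log (1 / r)) := Real.log_pos h2
  exact_mod_cast (le_div_iff₀ hpos).2 h4

/-- The growth comparison between the lowest coefficient and a solution. -/
lemma exists_mul_characteristic_le {z₀ : ℂ} {k : ℕ} (hk : 1 ≤ k) {A : ℕ → ℂ → ℂ}
    (hA : ∀ j < k, IsMeromorphic (A j) z₀) {δ : ℝ} (hδ : 0 < δ)
    (hA₀ : liminf (fun r : ℝ ↦ ((proximity (A 0) z₀ r /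
        characteristic (A 0) z₀ r : ℝ) : EReal)) (𝓝[>] 0) = (δ : EReal))
    (hA_dom : limsup (fun r : ℝ ↦ (((∑ j ∈ Finset.Ico 1 k, proximity (A j) z₀ r) /
        proximity (A 0) z₀ r : ℝ) : EReal)) (𝓝[>] 0) < 1)
    {f : ℂ → ℂ} (hf : IsMeromorphic f z₀) (hf_ne : ¬ SameFun f (fun _ ↦ 0) z₀)
    (hf_sol : IsSolution k A f z₀) :
    ∃ K, 0 ≤ K ∧ ∀ᶠ r : ℝ in 𝓝[>] 0, characteristic (A 0) z₀ r
      ≤ K * (Real.posLog (characteristic f z₀ ((4 ^ k)⁻¹ * r)) + Real.log (1 / r) + 1) := by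
  obtain ⟨K, hK0, hK⟩ := exists_proximity_coeff_zero_le hk (fun j hj ↦ (hA j hj).toPlane)
    hf.toPlane (meromorphicOrderAt_toPlane_ne_top hf hf_ne) (hf_sol.toPlane hA hf)
  obtain ⟨c, hc, hc1⟩ := EReal.lt_iff_exists_real_btwn.1 hA_dom
  have hc1 : c < 1 := by exact_mod_cast hc1
  have h1c : 0 < 1 - c := sub_pos.2 hc1
  have hδ2 : ((δ / 2 : ℝ) : EReal) < (δ : EReal) := by exact_mod_cast half_lt_self hδ
  rw [← hA₀] at hδ2
  refine ⟨((1 - c) * (δ / 2))⁻¹ * K, by positivity, ?_⟩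
  filter_upwards [eventually_lt_of_limsup_lt hc, eventually_lt_of_lt_liminf hδ2,
    Ioo_mem_nhdsGT one_pos] with r h1 h2 hr
  have h1 : (∑ j ∈ Finset.Ico 1 k, proximity (A j) z₀ r) / proximity (A 0) z₀ r < c := by
    exact_mod_cast h1
  have h2 : δ / 2 < proximity (A 0) z₀ r / characteristic (A 0) z₀ r := by exact_mod_cast h2
  have hr1 : 1 ≤ r⁻¹ := one_le_inv_iff₀.2 ⟨hr.1, hr.2.le⟩
  have h3 := hK r⁻¹ hr1
  have hT0 : 0 ≤ characteristic (A 0) z₀ r := by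
    rw [characteristic_eq (hA 0 (by omega)) hr.1]
    exact ValueDistribution.characteristic_nonneg hr1
  -- If `T` vanished, the quotient would be 0 by convention, contradicting its lower bound `δ/2`.
  have hTpos : 0 < characteristic (A 0) z₀ r := by
    refine lt_of_le_of_ne hT0 fun h ↦ ?_
    rw [← h, div_zero] at h2
    linarith
  have h4 : δ / 2 * characteristic (A 0) z₀ r < proximity (A 0) z₀ r := (lt_div_iff₀ hTpos).1 h2
  have hmpos : 0 < proximity (A 0) z₀ r := lt_of_le_of_lt (by positivity) h4
  have h5 := (div_lt_iff₀ hmpos).1 h1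
  have hr4 : (4 : ℝ) ^ k * r⁻¹ = ((4 ^ k)⁻¹ * r)⁻¹ := by rw [mul_inv, inv_inv]
  have h4k : (0 : ℝ) < (4 ^ k)⁻¹ * r := mul_pos (by positivity) hr.1
  simp only [← proximity_eq] at h3
  rw [hr4, ← characteristic_eq hf h4k, ← one_div r] at h3
  rw [mul_assoc, le_inv_mul_iff₀ (by positivity), mul_assoc]
  calc (1 - c) * (δ / 2 * characteristic (A 0) z₀ r) ≤ (1 - c) * proximity (A 0) z₀ r := by
        gcongr
    _ ≤ _ := by linarith

/-- Take `1 < b' < b` below the lower order of `F` and apply the hypothesis at `4ᵏ r`, so that `f`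
is evaluated at `r`. This only shifts `x = log (1/r)` by the constant `κ`. Since `b' > 1`, both `x`
and `1` are at most `x ^ b'`. -/
lemma logLowerOrder_le_lowerOrder22 {F f : ℂ → ℂ} {z₀ : ℂ} {k : ℕ} {K : ℝ}
    (hF : IsMeromorphic F z₀) (hK0 : 0 ≤ K)
    (hK : ∀ᶠ r : ℝ in 𝓝[>] 0, characteristic F z₀ r
      ≤ K * (Real.posLog (characteristic f z₀ ((4 ^ k)⁻¹ * r)) + Real.log (1 / r) + 1))
    (h1 : 1 < logLowerOrder F z₀) : logLowerOrder F z₀ ≤ lowerOrder22 f z₀ := by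
  refine le_of_forall_lt_imp_le_of_dense fun c hc ↦ ?_
  obtain ⟨b', hb'1, hb'2⟩ := EReal.lt_iff_exists_real_btwn.1 (max_lt hc h1)
  obtain ⟨b, hbb', hb⟩ := EReal.lt_iff_exists_real_btwn.1 hb'2
  have hb1 : 1 < b' := by exact_mod_cast (le_max_right c 1).trans_lt hb'1
  have hbb : b' < b := by exact_mod_cast hbb'
  refine ((le_max_left c 1).trans hb'1.le).trans (le_liminf_of_le (by isBoundedDefault) ?_)
  set κ : ℝ := Real.log (4 ^ k) with hκ
  have hκ0 : 0 ≤ κ := Real.log_nonneg (one_le_pow₀ (by norm_num))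
  have hscale : Tendsto (fun r : ℝ ↦ 4 ^ k * r) (𝓝[>] 0) (𝓝[>] 0) := by
    refine tendsto_nhdsWithin_iff.2 ⟨?_, ?_⟩
    · have : Tendsto (fun r : ℝ ↦ (4 : ℝ) ^ k * r) (𝓝 0) (𝓝 (4 ^ k * 0)) :=
        (continuous_const.mul continuous_id).tendsto 0
      rw [mul_zero] at this
      exact this.mono_left nhdsWithin_le_nhds
    · filter_upwards [self_mem_nhdsWithin] with r hr
      have hr : 0 < r := hr
      exact Set.mem_Ioi.2 (by positivity)
  have hevF : ∀ᶠ r : ℝ in 𝓝[>] 0, Real.log (1 / r) ^ b ≤ characteristic F z₀ r := by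
    filter_upwards [eventually_lt_of_lt_liminf hb, tendsto_log_one_div.eventually_gt_atTop 1,
      Ioo_mem_nhdsGT one_pos] with r h2 h3 hr
    have h2 : b < Real.posLog (characteristic F z₀ r) / Real.log (Real.log (1 / r)) := by
      exact_mod_cast h2
    have hpos : 0 < Real.log (Real.log (1 / r)) := Real.log_pos h3
    refine rpow_le_of_mul_log_lt_posLog (by linarith)
      (mul_nonneg (by linarith) hpos.le) ((lt_div_iff₀ hpos).1 h2) ?_
    rw [characteristic_eq hF hr.1]
    exact ValueDistribution.characteristic_nonneg (one_le_inv_iff₀.2 ⟨hr.1, hr.2.le⟩)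
  -- Were `s < x ^ b'`, the right side `K (s + x + 1)` would be at most `3K x ^ b'`; the constant
  -- `3K + 1` contradicts this.
  filter_upwards [hscale.eventually (hK.and hevF),
    tendsto_log_one_div.eventually (eventually_mul_rpow_le hbb (by linarith) (3 * K + 1) κ),
    tendsto_log_one_div.eventually_gt_atTop 1, self_mem_nhdsWithin] with r h2 h3 h4 hr
  have hr : 0 < r := hr
  have h4k : (0 : ℝ) < 4 ^ k := by positivity
  have hL : Real.log (1 / (4 ^ k * r)) = Real.log (1 / r) - κ := by
    rw [hκ, one_div, one_div, Real.log_inv, Real.log_inv, Real.log_mul h4k.ne' hr.ne']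
    ring
  rw [inv_mul_cancel_left₀ h4k.ne', hL] at h2
  set x := Real.log (1 / r) with hx
  have hxb : x ≤ x ^ b' := Real.self_le_rpow_of_one_le h4.le hb1.le
  have hxpos : 0 < x ^ b' := by linarith
  set s := Real.posLog (characteristic f z₀ r) with hs
  have hs0 : 0 ≤ s := Real.posLog_nonneg
  have hKs : 3 * K * x ^ b' + x ^ b' ≤ K * (s + x + 1) := by
    have : K * (s + (x - κ) + 1) ≤ K * (s + x + 1) := by gcongr; linarith
    linarith [h2.1, h2.2]
  have hxs : x ^ b' ≤ s := by
    by_contra! hlt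
    have : K * (s + x + 1) ≤ K * (3 * x ^ b') := by
      gcongr
      linarith
    linarith
  have h5 := mul_log_le_posLog (by linarith) hxs
  have hpos : 0 < Real.log x := Real.log_pos h4
  exact_mod_cast (le_div_iff₀ hpos).2 h5

end PuncturedSphere

theorem theorem4 (z₀ : ℂ) (k : ℕ) (hk : 1 ≤ k) (A : ℕ → ℂ → ℂ)
    (hA : ∀ j < k, PuncturedSphere.IsMeromorphic (A j) z₀)
    (hA_order : ∀ j < k, PuncturedSphere.logOrder (A j) z₀ < ⊤)
    (δ : ℝ) (hδ : 0 < δ)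
    (hA₀ : liminf (fun r : ℝ ↦ ((PuncturedSphere.proximity (A 0) z₀ r /
        PuncturedSphere.characteristic (A 0) z₀ r : ℝ) : EReal)) (𝓝[>] 0) = (δ : EReal))
    (hA_dom : limsup (fun r : ℝ ↦ (((∑ j ∈ Finset.Ico 1 k, PuncturedSphere.proximity (A j) z₀ r) /
        PuncturedSphere.proximity (A 0) z₀ r : ℝ) : EReal)) (𝓝[>] 0) < 1)
    (f : ℂ → ℂ) (hf : PuncturedSphere.IsMeromorphic f z₀)
    (hf_ne : ¬ PuncturedSphere.SameFun f (fun _ ↦ 0) z₀)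
    (hf_sol : PuncturedSphere.IsSolution k A f z₀) :
    ((¬ ∃ c : ℂ, PuncturedSphere.SameFun (A 0) (fun _ ↦ c) z₀) →
      0 ≤ PuncturedSphere.logLowerOrder (A 0) z₀ - 1) ∧
    PuncturedSphere.logLowerOrder (A 0) z₀ - 1 ≤ PuncturedSphere.lowerOrder22 f z₀ ∧
    (1 < PuncturedSphere.logLowerOrder (A 0) z₀ →
      PuncturedSphere.logLowerOrder (A 0) z₀ ≤ PuncturedSphere.lowerOrder22 f z₀) := by
  have hA0 := hA 0 (by omega)
  obtain ⟨K, hK0, hK⟩ := PuncturedSphere.exists_mul_characteristic_le hk hA hδ hA₀ hA_dom hf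
    hf_ne hf_sol
  have hmain := PuncturedSphere.logLowerOrder_le_lowerOrder22 hA0 hK0 hK
  have h11 : (1 : EReal) - 1 = 0 := by
    rw [← EReal.coe_one, ← EReal.coe_sub, sub_self, EReal.coe_zero]
  refine ⟨fun hne ↦ ?_, ?_, hmain⟩
  · rw [← h11]
    exact EReal.sub_le_sub (PuncturedSphere.one_le_logLowerOrder hA0 hne) le_rfl
  · rcases le_or_gt (PuncturedSphere.logLowerOrder (A 0) z₀) 1 with h | h
    · refine (EReal.sub_le_sub h le_rfl).trans ?_
      rw [h11]
      exact PuncturedSphere.lowerOrder22_nonneg f z₀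
    · refine le_trans ?_ (hmain h)
      calc PuncturedSphere.logLowerOrder (A 0) z₀ - 1
          ≤ PuncturedSphere.logLowerOrder (A 0) z₀ - 0 := EReal.sub_le_sub le_rfl zero_le_one
        _ = _ := sub_zero _
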